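/- Let $J>0$, and consider the Curie–Weiss model with external field generated by the rotation $T x=x+\alpha \bmod 1$ of the circle $\mathbb T^1=\mathbb R/\mathbb Z$ (with Lebesgue measure $\lambda$) and the function $f(x)=x$, where $x\in[0,1)$ represents a point of $\mathbb T^1$. That is, for $\beta>0$, $x\in\mathbb T^1$ and $n\ge 1$, let $\mathbb Q_{n,x}$ be the Gibbs probability measure on $\{-1,1\}^n$ given by $$\mathbb Q_{n,x}(\sigma)=\frac1{Z_{n,x}}\exp\Big(\frac{\beta J}{2n}\Big(\sum_{i=1}^n\sigma_i\Big)^2+\frac12\sum_{i=1}^n\log\Big(\frac{f(T^ix)}{1-f(T^ix)}\Big)\sigma_i\Big),$$ equivalently, the probability measure with $$\mathbb Q_{n,x}(\sigma)\ \propto\ \exp\Big(\frac{\beta J}{2n}\Big(\sum_{i=1}^n\sigma_i\Big)^2\Big)\prod_{i:\sigma_i=1}f(T^ix)\prod_{i:\sigma_i=-1}(1-f(T^ix))$$ (this second form defines $\mathbb Q_{n,x}$ also when $f(T^ix)=0$ for some $i$), and let $M_n=\sum_{i=1}^n\sigma_i$ under $\mathbb Q_{n,x}$. Put $$G_\beta(s)=\frac{\beta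 J}{2}s^2-\int_0^1\log\big(y\,e^{\beta Js}+(1-y)\,e^{-\beta Js}\big)\,dy,\qquad \beta_c=\sup\{\beta>0:\ G_\beta(s)\ge 0\ \text{for all } s\in\mathbb R\}.$$ An irrational $\alpha$ is of type $\eta\in\mathbb R$ if $\eta$ is the infimum of all real $\sigma$ for which there is a constant $c>0$ with $\max(1,|h|)^{\sigma}\,\|h\alpha\|\ge c$ for all integers $h\ne0$, where $\|t\|$ is the distance from $t$ to the nearest integer. Write $\Rightarrow$ for convergence in distribution as $n\to\infty$. Then the following hold. 1. $\beta_c=\dfrac{3}{2J}$. 2. If $0<\beta<\beta_c$, and $\alpha$ is an irrational number of type $\eta<2$, then for every $x\in\mathbb T^1$, under $\mathbb Q_{n,x}$, $$\frac{M_n}{n}\Rightarrow\delta_0\qquad\text{and}\qquad \frac{M_n}{\sqrt n}\Rightarrow\mathcal N(0,\sigma^2),\quad \sigma^2=\frac{2}{3-2\beta J}.$$ 3. If $\beta=\beta_c$, and $\alpha$ is an irrational number of type $\eta<4/3$, then for every $x\in\mathbb T^1$, under $\mathbb Q_{n,x}$, $$\frac{M_n}{n}\Rightarrow\delta_0\qquad\text{and}\qquad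 \frac{M_n}{n^{3/4}}\Rightarrow Z,$$ where $Z$ is the probability measure on $\mathbb R$ with density $$s\mapsto\frac{\sqrt3\,\Gamma(3/4)}{\sqrt2\,\pi\,5^{1/4}}\exp\Big(-\frac{9s^4}{80}\Big).$$ -/

import Mathlib

open MeasureTheory ProbabilityTheory Filter Topology

noncomputable section

namespace CurieWeiss

section Model

variable {E : Type*}

/-- The total magnetization `M_n = σ_1 + ⋯ + σ_n` of a configuration `σ ∈ {-1, 1}^n`
(the spins are elements of `ℤˣ = {1, -1}`). -/
def magnetization {n : ℕ} (σ : Fin n → ℤˣ) : ℝ :=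
  ∑ i, ((σ i : ℤ) : ℝ)

/-- The Hamiltonian `(βJ / 2n) (∑ σ_i)² + (1/2) ∑ log (f(T^i x) / (1 - f(T^i x))) σ_i`,
the sums running over `i = 1, …, n`. It is meaningful when `0 < f(T^i x) < 1` for all these `i`. -/
def hamiltonian (T : E → E) (f : E → unitInterval) (β J : ℝ) (x : E) (n : ℕ)
    (σ : Fin n → ℤˣ) : ℝ :=
  β * J / (2 * n) * (∑ i, ((σ i : ℤ) : ℝ)) ^ 2
    + 1 / 2 * ∑ i : Fin n,
        Real.log ((f (T^[(i : ℕ) + 1] x) : ℝ) / (1 - (f (T^[(i : ℕ) + 1] x) : ℝ)))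
          * ((σ i : ℤ) : ℝ)

/-- Law of one step of the dynamic random walk: `1` with probability `p` and `-1` with
probability `1 - p`. -/
def stepProb (p : ℝ) (s : ℤˣ) : ℝ := if s = 1 then p else 1 - p

/-- Unnormalized weight of the Gibbs measure: the density `exp ((βJ / 2n) M_n²)` times the
probability of `σ` under the product law `∏ (f(T^i x) δ_1 + (1 - f(T^i x)) δ_{-1})`.
After normalization this is `exp (hamiltonian σ)` divided by the partition function whenever the
Hamiltonian is meaningful (see `gibbsProb_eq_exp_hamiltonian`), and it remains meaningful when `f`
takes the value `0` or `1` on the orbit of `x`. -/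
def gibbsWeight (T : E → E) (f : E → unitInterval) (β J : ℝ) (x : E) (n : ℕ)
    (σ : Fin n → ℤˣ) : ℝ :=
  Real.exp (β * J / (2 * n) * magnetization σ ^ 2)
    * ∏ i : Fin n, stepProb (f (T^[(i : ℕ) + 1] x)) (σ i)

/-- The Gibbs probability `ℚ_{n,x}(σ)` of a configuration. -/
def gibbsProb (T : E → E) (f : E → unitInterval) (β J : ℝ) (x : E) (n : ℕ)
    (σ : Fin n → ℤˣ) : ℝ :=
  gibbsWeight T f β J x n σ / ∑ τ, gibbsWeight T f β J x n τ

/-- The Gibbs measure `ℚ_{n,x}` on `{-1, 1}^n`. -/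
def gibbsMeasure (T : E → E) (f : E → unitInterval) (β J : ℝ) (x : E) (n : ℕ) :
    Measure (Fin n → ℤˣ) :=
  ∑ σ, ENNReal.ofReal (gibbsProb T f β J x n σ) • Measure.dirac σ

theorem stepProb_nonneg (p : unitInterval) (s : ℤˣ) : 0 ≤ stepProb p s := by
  unfold stepProb
  split_ifs
  · exact p.2.1
  · linarith [p.2.2]

theorem gibbsWeight_nonneg (T : E → E) (f : E → unitInterval) (β J : ℝ) (x : E) (n : ℕ)
    (σ : Fin n → ℤˣ) : 0 ≤ gibbsWeight T f β J x n σ :=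
  mul_nonneg (Real.exp_pos _).le (Finset.prod_nonneg fun _ _ => stepProb_nonneg _ _)

theorem sum_gibbsWeight_pos (T : E → E) (f : E → unitInterval) (β J : ℝ) (x : E) (n : ℕ) :
    0 < ∑ σ, gibbsWeight T f β J x n σ := by
  have hex : ∀ p : unitInterval, ∃ s : ℤˣ, 0 < stepProb p s := by
    intro p
    by_cases h : 0 < (p : ℝ)
    · exact ⟨1, by simpa [stepProb] using h⟩
    · refine ⟨-1, ?_⟩
      have hne : (-1 : ℤˣ) ≠ 1 := by decide
      simp only [stepProb, if_neg hne]
      linarith [p.2.1]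
  choose s hs using hex
  refine Finset.sum_pos' (fun σ _ => gibbsWeight_nonneg T f β J x n σ)
    ⟨fun i => s (f (T^[(i : ℕ) + 1] x)), Finset.mem_univ _, ?_⟩
  exact mul_pos (Real.exp_pos _) (Finset.prod_pos fun _ _ => hs _)

theorem gibbsProb_nonneg (T : E → E) (f : E → unitInterval) (β J : ℝ) (x : E) (n : ℕ)
    (σ : Fin n → ℤˣ) : 0 ≤ gibbsProb T f β J x n σ :=
  div_nonneg (gibbsWeight_nonneg _ _ _ _ _ _ _) (sum_gibbsWeight_pos _ _ _ _ _ _).le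

instance isProbabilityMeasure_gibbsMeasure (T : E → E) (f : E → unitInterval) (β J : ℝ) (x : E)
    (n : ℕ) : IsProbabilityMeasure (gibbsMeasure T f β J x n) := by
  constructor
  simp only [gibbsMeasure, Measure.coe_finsetSum, Finset.sum_apply, Measure.smul_apply,
    measure_univ, smul_eq_mul, mul_one]
  rw [← ENNReal.ofReal_sum_of_nonneg fun σ _ => gibbsProb_nonneg T f β J x n σ]
  simp only [gibbsProb]
  rw [← Finset.sum_div, div_self (sum_gibbsWeight_pos T f β J x n).ne', ENNReal.ofReal_one]

/-- Where the Hamiltonian is meaningful, `ℚ_{n,x}(σ) = exp (H(σ)) / Z`. -/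
theorem gibbsProb_eq_exp_hamiltonian (T : E → E) (f : E → unitInterval) (β J : ℝ) (x : E) (n : ℕ)
    (hf : ∀ i : Fin n, (f (T^[(i : ℕ) + 1] x) : ℝ) ∈ Set.Ioo (0 : ℝ) 1) (σ : Fin n → ℤˣ) :
    gibbsProb T f β J x n σ =
      Real.exp (hamiltonian T f β J x n σ) / ∑ τ, Real.exp (hamiltonian T f β J x n τ) := by
  have key : ∀ p : ℝ, p ∈ Set.Ioo (0 : ℝ) 1 → ∀ s : ℤˣ, stepProb p s =
      Real.sqrt (p * (1 - p)) * Real.exp (1 / 2 * (Real.log (p / (1 - p)) * ((s : ℤ) : ℝ))) := by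
    intro p hp s
    have h0 : 0 < p := hp.1
    have h1 : 0 < 1 - p := by linarith [hp.2]
    have hsq : Real.sqrt (p * (1 - p)) = Real.exp (1 / 2 * (Real.log p + Real.log (1 - p))) := by
      rw [Real.sqrt_eq_rpow, Real.rpow_def_of_pos (mul_pos h0 h1),
        Real.log_mul h0.ne' h1.ne', mul_comm]
    rw [hsq, ← Real.exp_add, Real.log_div h0.ne' h1.ne']
    rcases Int.units_eq_one_or s with rfl | rfl
    · have : stepProb p 1 = p := by simp [stepProb]
      rw [this]
      nth_rewrite 1 [← Real.exp_log h0]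
      congr 1
      push_cast
      ring
    · have hne : (-1 : ℤˣ) ≠ 1 := by decide
      have : stepProb p (-1) = 1 - p := by simp only [stepProb, if_neg hne]
      rw [this]
      nth_rewrite 1 [← Real.exp_log h1]
      congr 1
      push_cast
      ring
  set c : ℝ := ∏ i : Fin n,
    Real.sqrt ((f (T^[(i : ℕ) + 1] x) : ℝ) * (1 - (f (T^[(i : ℕ) + 1] x) : ℝ))) with hc
  have hcpos : 0 < c := Finset.prod_pos fun i _ =>
    Real.sqrt_pos.2 (mul_pos (hf i).1 (by linarith [(hf i).2]))
  have hw : ∀ τ, gibbsWeight T f β J x n τ = c * Real.exp (hamiltonian T f β J x n τ) := by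
    intro τ
    simp only [gibbsWeight, hamiltonian, magnetization]
    rw [Finset.prod_congr rfl fun i _ => key _ (hf i) (τ i), Finset.prod_mul_distrib,
      ← Real.exp_sum, Real.exp_add, Finset.mul_sum]
    ring
  simp only [gibbsProb, hw]
  rw [← Finset.mul_sum, mul_div_mul_left _ _ hcpos.ne']

end Model

section CriticalTemperature

variable {E : Type*} [MeasurableSpace E]

/-- `Λ(u) = ∫ log (f(y) e^u + (1 - f(y)) e^{-u}) dμ(y)`. -/
def logMoment (μ : Measure E) (f : E → unitInterval) (u : ℝ) : ℝ :=
  ∫ y, Real.log ((f y : ℝ) * Real.exp u + (1 - (f y : ℝ)) * Real.exp (-u)) ∂μ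

/-- `G_β(s) = (βJ / 2) s² - Λ(βJs)`. -/
def freeEnergy (μ : Measure E) (f : E → unitInterval) (β J s : ℝ) : ℝ :=
  β * J / 2 * s ^ 2 - logMoment μ f (β * J * s)

/-- The critical inverse temperature `β_c = sup {β > 0 | ∀ s, G_β(s) ≥ 0}`. -/
def criticalBeta (μ : Measure E) (f : E → unitInterval) (J : ℝ) : ℝ :=
  sSup {β : ℝ | 0 < β ∧ ∀ s : ℝ, 0 ≤ freeEnergy μ f β J s}

end CriticalTemperature

/-- `η` is the type of the irrational number `α`: the infimum of all `σ` for which there is `c > 0`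
with `max(1,|h|)^σ ‖hα‖ ≥ c` for every nonzero integer `h`, where `‖t‖` is the distance from `t`
to the nearest integer. (A number for which no such `σ` exists has no real type.) -/
def HasType (α η : ℝ) : Prop :=
  IsGLB {σ : ℝ | ∃ c : ℝ, 0 < c ∧ ∀ h : ℤ, h ≠ 0 →
    c ≤ (max 1 |(h : ℝ)|) ^ σ * |h * α - round (h * α)|} η

/-- The rotation `x ↦ x + α` of the circle `ℝ/ℤ`. -/
def rotation (α : ℝ) (x : UnitAddCircle) : UnitAddCircle := x + (α : UnitAddCircle)

/-- The function `f(x) = x` on the circle: the representative of `x` in `[0, 1)`. -/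
def coordinate (x : UnitAddCircle) : unitInterval :=
  ⟨(AddCircle.equivIco 1 0 x : ℝ),
    (AddCircle.equivIco 1 0 x).2.1, by simpa using (AddCircle.equivIco 1 0 x).2.2.le⟩

/-- The measure on `ℝ` with density
`√3 Γ(3/4) / (√2 π 5^{1/4}) · exp (-9 s⁴ / 80)`. -/
def quarticLaw : Measure ℝ :=
  volume.withDensity fun s => ENNReal.ofReal
    (Real.sqrt 3 * Real.Gamma (3 / 4) / (Real.sqrt 2 * Real.pi * (5 : ℝ) ^ (1 / 4 : ℝ))
      * Real.exp (-9 * s ^ 4 / 80))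

end CurieWeiss

end

/-! Write `B = β * J`. Linearizing the square in the Gibbs weight by a Gaussian integral
(`charFun_magnetization`) shows that `M_n / (n r)` plus an independent centred Gaussian of variance
`1 / (n B r²)` has density proportional to `exp (-n G_n(r y))`. Here `G_n` is the free energy with
the space average of `stepLog` replaced by its average along the orbit. Everything thus reduces to
the behaviour of `n G_n(n^(-κ) y)`.

The space average is explicit: `Λ(u) = u coth u - 1 = u²/3 - u⁴/45 + ⋯`. Hence `G(s) = (B/2 - B²/3)
s² + D(B s)`, with a defect `D ≥ 0` that is of order `u⁴` at `0`. The sign of the quadratic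
coefficient puts the critical point at `B = 3/2`. For smaller `B` the quadratic term dominates at `κ
= 1/2`; at `B = 3/2` only the quartic term is left, and `κ = 1/4` is the right scale.

The difference `n (G_n - G)` is, up to sign, the discrepancy of an ergodic sum of `stepLog (B s)`, a
monotone function of variation `2 B |s|`. The Denjoy–Koksma inequality (`denjoy_koksma`), applied
along Dirichlet approximations of `α` whose denominators are large by the Diophantine condition,
bounds it by `O(|s| n^γ)` with `γ = 1 - 1/σ` (`exists_rotationDeviation_le`). At scale `n^(-κ)` this
is negligible when `γ < κ`, which can be arranged for type below `1 / (1 - κ)`: this is `2` for `κ =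
1/2` and `4/3` for `κ = 1/4`.

Dominated convergence then gives the limiting characteristic functions
(`tendsto_charFun_magnetization`). The auxiliary Gaussian is divided out at `κ = 1/2` and disappears
in the limit at `κ = 1/4`. -/

namespace CurieWeiss

/-! ### Two-sided Taylor bounds for `u coth u`. -/

section Hyperbolic

open Real

/-- The difference `g - f` is monotone on the half-line. The hyperbolic inequalities below are
chained through this, one serving as the derivative comparison for the next. -/
theorem le_of_hasDerivAt_le {f g f' g' : ℝ → ℝ} (hf : ∀ x, HasDerivAt f (f' x) x)
    (hg : ∀ x, HasDerivAt g (g' x) x) (h0 : f 0 ≤ g 0) (h : ∀ x, 0 ≤ x → f' x ≤ g' x)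
    {x : ℝ} (hx : 0 ≤ x) : f x ≤ g x := by
  have hd : ∀ y, HasDerivAt (fun y => g y - f y) (g' y - f' y) y := fun y => (hg y).sub (hf y)
  have hm : MonotoneOn (fun y => g y - f y) (Set.Ici 0) := by
    refine monotoneOn_of_deriv_nonneg (convex_Ici 0)
      (fun y _ => (hd y).continuousAt.continuousWithinAt)
      (fun y _ => (hd y).differentiableAt.differentiableWithinAt) fun y hy => ?_
    rw [interior_Ici] at hy
    rw [(hd y).deriv]
    linarith [h y (le_of_lt hy)]
  have := hm Set.self_mem_Ici hx hx
  simp only at this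
  linarith

theorem hasDerivAt_mul_cosh_sub_sinh (x : ℝ) :
    HasDerivAt (fun x => x * cosh x - sinh x) (x * sinh x) x := by
  have := ((hasDerivAt_id x).mul (hasDerivAt_cosh x)).sub (hasDerivAt_sinh x)
  refine this.congr_deriv ?_
  simp

theorem hasDerivAt_coth_numerator (x : ℝ) :
    HasDerivAt (fun x => (x ^ 2 / 3 + 1) * sinh x - x * cosh x)
      (x / 3 * (x * cosh x - sinh x)) x := by
  have := ((((hasDerivAt_pow 2 x).div_const 3).add_const 1).mul (hasDerivAt_sinh x)).sub
    ((hasDerivAt_id x).mul (hasDerivAt_cosh x))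
  refine this.congr_deriv ?_
  simp
  ring

theorem hasDerivAt_pow_mul_cosh (n : ℕ) (c x : ℝ) :
    HasDerivAt (fun x => x ^ (n + 1) / c * cosh x)
      ((n + 1) * x ^ n / c * cosh x + x ^ (n + 1) / c * sinh x) x := by
  have := ((hasDerivAt_pow (n + 1) x).div_const c).mul (hasDerivAt_cosh x)
  refine this.congr_deriv ?_
  simp

theorem sinh_le_mul_cosh {x : ℝ} (hx : 0 ≤ x) : sinh x ≤ x * cosh x := by
  refine le_of_hasDerivAt_le hasDerivAt_sinh (g := fun x => x * cosh x)
    (g' := fun x => cosh x + x * sinh x) (fun x => ?_) (by simp) (fun x hx => ?_) hx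
  · refine ((hasDerivAt_id x).mul (hasDerivAt_cosh x)).congr_deriv ?_
    simp
  · have := mul_nonneg hx (sinh_nonneg_iff.2 hx)
    linarith

theorem cube_le_mul_cosh_sub_sinh {x : ℝ} (hx : 0 ≤ x) :
    x ^ 3 / 3 ≤ x * cosh x - sinh x := by
  refine le_of_hasDerivAt_le (f := fun x => x ^ 3 / 3) (f' := fun x => x ^ 2) (fun x => ?_)
    hasDerivAt_mul_cosh_sub_sinh (by simp) (fun x hx => ?_) hx
  · refine ((hasDerivAt_pow 3 x).div_const 3).congr_deriv ?_
    norm_num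
  · nlinarith [self_le_sinh_iff.2 hx]

theorem mul_cosh_sub_sinh_le {x : ℝ} (hx : 0 ≤ x) :
    x * cosh x - sinh x ≤ x ^ 3 / 3 * cosh x := by
  refine le_of_hasDerivAt_le hasDerivAt_mul_cosh_sub_sinh
    (hasDerivAt_pow_mul_cosh 2 3) (by simp) (fun x hx => ?_) hx
  have h1 := mul_le_mul_of_nonneg_left (sinh_le_mul_cosh hx) hx
  have h2 : 0 ≤ x ^ 3 / 3 * sinh x := mul_nonneg (by positivity) (sinh_nonneg_iff.2 hx)
  norm_num at h1 h2 ⊢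
  nlinarith

theorem pow_five_le_coth_numerator {x : ℝ} (hx : 0 ≤ x) :
    x ^ 5 / 45 ≤ (x ^ 2 / 3 + 1) * sinh x - x * cosh x := by
  refine le_of_hasDerivAt_le (f := fun x => x ^ 5 / 45) (f' := fun x => x ^ 4 / 9) (fun x => ?_)
    hasDerivAt_coth_numerator (by simp) (fun x hx => ?_) hx
  · refine ((hasDerivAt_pow 5 x).div_const 45).congr_deriv ?_
    norm_num
    ring
  · have := mul_le_mul_of_nonneg_left (cube_le_mul_cosh_sub_sinh hx) (by positivity : 0 ≤ x / 3)
    linarith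

/-- The extra factor `cosh x` leaves a nonnegative `sinh` term to spare on differentiating, and
tends to `1` at the origin. So the constant `1/45` matches that of `pow_five_le_coth_numerator` and
identifies the quartic coefficient. -/
theorem coth_numerator_le {x : ℝ} (hx : 0 ≤ x) :
    (x ^ 2 / 3 + 1) * sinh x - x * cosh x ≤ x ^ 5 / 45 * cosh x := by
  refine le_of_hasDerivAt_le hasDerivAt_coth_numerator
    (hasDerivAt_pow_mul_cosh 4 45) (by simp) (fun x hx => ?_) hx
  have h1 := mul_le_mul_of_nonneg_left (mul_cosh_sub_sinh_le hx) (by positivity : 0 ≤ x / 3)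
  have h2 : 0 ≤ x ^ 5 / 45 * sinh x := mul_nonneg (by positivity) (sinh_nonneg_iff.2 hx)
  norm_num at h1 h2 ⊢
  linarith

/-- The difference `u² / 3 - (u coth u - 1)`. -/
noncomputable def cothDefect (u : ℝ) : ℝ := u ^ 2 / 3 + 1 - u * cosh u / sinh u

@[simp]
theorem cothDefect_neg (u : ℝ) : cothDefect (-u) = cothDefect u := by
  simp [cothDefect, neg_div_neg_eq]

theorem cothDefect_abs (u : ℝ) : cothDefect |u| = cothDefect u := by
  rcases abs_choice u with h | h <;> simp [h]

theorem cothDefect_eq_div {u : ℝ} (hu : u ≠ 0) :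
    cothDefect u = ((u ^ 2 / 3 + 1) * sinh u - u * cosh u) / sinh u := by
  have : sinh u ≠ 0 := by simpa using hu
  rw [cothDefect]
  field_simp

theorem div_sinh_le_cothDefect {u : ℝ} (hu : 0 < u) :
    u ^ 5 / 45 / sinh u ≤ cothDefect u := by
  rw [cothDefect_eq_div hu.ne']
  exact div_le_div_of_nonneg_right (pow_five_le_coth_numerator hu.le) (sinh_pos_iff.2 hu).le

/-- Evenness reduces to `u > 0`, where `u ≤ sinh u` cancels the denominator. The point `0` must be
excluded, since division by zero makes `cothDefect 0 = 1`. -/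
theorem cothDefect_le {u : ℝ} (hu : u ≠ 0) : cothDefect u ≤ u ^ 4 / 45 * cosh u := by
  have key : ∀ v : ℝ, 0 < v → cothDefect v ≤ v ^ 4 / 45 * cosh v := by
    intro v hv
    rw [cothDefect_eq_div hv.ne', div_le_iff₀ (sinh_pos_iff.2 hv)]
    refine (coth_numerator_le hv.le).trans ?_
    have h1 : 0 ≤ v ^ 4 / 45 * cosh v := mul_nonneg (by positivity) (cosh_pos v).le
    have := mul_le_mul_of_nonneg_left (self_le_sinh_iff.2 hv.le) h1
    linarith
  have := key |u| (abs_pos.2 hu)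
  rwa [cothDefect_abs, cosh_abs, Even.pow_abs (by decide)] at this

theorem le_cothDefect {u : ℝ} (hu : u ≠ 0) : u ^ 4 / (45 * cosh u) ≤ cothDefect u := by
  have key : ∀ v : ℝ, 0 < v → v ^ 4 / (45 * cosh v) ≤ cothDefect v := by
    intro v hv
    refine le_trans ?_ (div_sinh_le_cothDefect hv)
    have hs := sinh_pos_iff.2 hv
    have hc := cosh_pos v
    rw [div_div, div_le_div_iff₀ (by positivity) (by positivity)]
    have := mul_le_mul_of_nonneg_left (sinh_le_mul_cosh hv.le) (by positivity : 0 ≤ 45 * v ^ 4)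
    linarith
  have := key |u| (abs_pos.2 hu)
  rwa [cothDefect_abs, cosh_abs, Even.pow_abs (by decide)] at this

theorem cothDefect_nonneg {u : ℝ} (hu : u ≠ 0) : 0 ≤ cothDefect u :=
  le_trans (div_nonneg (by positivity) (mul_nonneg (by norm_num) (cosh_pos u).le))
    (le_cothDefect hu)

/-- For `v > 0` large, `v coth v ≤ v + 1` because `v (cosh v - sinh v) = v e^(-v) ≤ 1 ≤ sinh v`.
What remains is `v²/3 - v ≥ v²/12`, which is where the threshold `4` comes from. -/
theorem sq_div_le_cothDefect {u : ℝ} (hu : 4 ≤ |u|) : u ^ 2 / 12 ≤ cothDefect u := by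
  have key : ∀ v : ℝ, 4 ≤ v → v ^ 2 / 12 ≤ cothDefect v := by
    intro v hv
    have hs : 0 < sinh v := sinh_pos_iff.2 (by linarith)
    have h : v * cosh v / sinh v ≤ v + 1 := by
      rw [div_le_iff₀ hs]
      have h1 : cosh v - sinh v = exp (-v) := cosh_sub_sinh v
      have h2 : v * exp (-v) ≤ 1 := by
        rw [exp_neg, ← div_eq_mul_inv, div_le_one (exp_pos v)]
        linarith [add_one_le_exp v]
      have h3 := self_le_sinh_iff.2 (by linarith : 0 ≤ v)
      have h4 : v * cosh v = v * sinh v + v * exp (-v) := by rw [← h1]; ring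
      linarith
    rw [cothDefect]
    nlinarith
  have := key |u| hu
  rwa [cothDefect_abs, sq_abs] at this

/-- This global bound supplies the domination at criticality, where the free energy has no quadratic
term of its own. -/
theorem exists_cothDefect_lower_bound :
    ∃ c : ℝ, 0 < c ∧ ∀ u : ℝ, u ≠ 0 → c * min (u ^ 4) (u ^ 2) ≤ cothDefect u := by
  have hc := cosh_pos 4
  have h1 : 1 ≤ cosh 4 := one_le_cosh 4
  refine ⟨1 / (45 * cosh 4), by positivity, fun u hu => ?_⟩
  rcases le_total |u| 4 with h | h
  · refine le_trans ?_ (le_cothDefect hu)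
    have h2 : cosh u ≤ cosh 4 := cosh_le_cosh.2 (by simpa using h)
    calc 1 / (45 * cosh 4) * min (u ^ 4) (u ^ 2) ≤ 1 / (45 * cosh 4) * u ^ 4 := by
          gcongr; exact min_le_left _ _
      _ = u ^ 4 / (45 * cosh 4) := by ring
      _ ≤ u ^ 4 / (45 * cosh u) := by
          have := cosh_pos u
          gcongr
  · refine le_trans ?_ (sq_div_le_cothDefect h)
    calc 1 / (45 * cosh 4) * min (u ^ 4) (u ^ 2) ≤ 1 / (45 * cosh 4) * u ^ 2 := by
          gcongr; exact min_le_right _ _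
      _ ≤ 1 / 12 * u ^ 2 := by gcongr; linarith
      _ = u ^ 2 / 12 := by ring

theorem tendsto_cothDefect_div_pow_four :
    Tendsto (fun u => cothDefect u / u ^ 4) (𝓝[≠] 0) (𝓝 (1 / 45)) := by
  have hcosh : Tendsto cosh (𝓝[≠] 0) (𝓝 1) := by
    have := (continuous_cosh.tendsto 0).mono_left (nhdsWithin_le_nhds (s := {0}ᶜ))
    rwa [cosh_zero] at this
  have hlow : Tendsto (fun u => 1 / 45 / cosh u) (𝓝[≠] 0) (𝓝 (1 / 45)) := by
    have := (tendsto_const_nhds (x := (1 / 45 : ℝ))).div hcosh one_ne_zero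
    rwa [div_one] at this
  have hupp : Tendsto (fun u => 1 / 45 * cosh u) (𝓝[≠] 0) (𝓝 (1 / 45)) := by
    simpa using (tendsto_const_nhds (x := (1 / 45 : ℝ))).mul hcosh
  refine tendsto_of_tendsto_of_tendsto_of_le_of_le' hlow hupp ?_ ?_ <;>
    filter_upwards [self_mem_nhdsWithin] with u hu <;>
    have hu : u ≠ 0 := hu <;>
    have hp : 0 < u ^ 4 := by positivity
  · rw [le_div_iff₀ hp]
    refine le_trans (le_of_eq ?_) (le_cothDefect hu)
    field_simp
  · rw [div_le_iff₀ hp]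
    refine (cothDefect_le hu).trans (le_of_eq ?_)
    ring

end Hyperbolic

/-! ### The explicit free energy and the critical temperature. -/

/-- The logarithm of the moment generating function at `u` of one step of the walk, as a function
of the probability `y` of a step upwards. -/
noncomputable def stepLog (u y : ℝ) : ℝ := Real.log (y * Real.exp u + (1 - y) * Real.exp (-u))

theorem step_mgf_pos (u : ℝ) {y : ℝ} (hy : y ∈ Set.Icc (0 : ℝ) 1) :
    0 < y * Real.exp u + (1 - y) * Real.exp (-u) := by
  have h1 := Real.exp_pos u
  have h2 := Real.exp_pos (-u)
  rcases hy.1.eq_or_lt with h | h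
  · simpa [← h] using h2
  · have := mul_pos h h1
    have := mul_nonneg (sub_nonneg.2 hy.2) h2.le
    linarith

@[simp]
theorem stepLog_apply_zero (u : ℝ) : stepLog u 0 = -u := by simp [stepLog]

@[simp]
theorem stepLog_apply_one (u : ℝ) : stepLog u 1 = u := by simp [stepLog]

theorem stepLog_monotoneOn {u : ℝ} (hu : 0 ≤ u) : MonotoneOn (stepLog u) (Set.Icc 0 1) := by
  intro a ha b hb hab
  refine Real.log_le_log (step_mgf_pos u ha) ?_
  have : Real.exp (-u) ≤ Real.exp u := Real.exp_le_exp.2 (by linarith)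
  nlinarith

theorem stepLog_antitoneOn {u : ℝ} (hu : u ≤ 0) : AntitoneOn (stepLog u) (Set.Icc 0 1) := by
  intro a ha b hb hab
  refine Real.log_le_log (step_mgf_pos u hb) ?_
  have : Real.exp u ≤ Real.exp (-u) := Real.exp_le_exp.2 (by linarith)
  nlinarith

theorem coordinate_coe (y : ℝ) : (coordinate (y : UnitAddCircle) : ℝ) = Int.fract y := by
  simp [coordinate]

theorem logMoment_coordinate_eq_integral (u : ℝ) :
    logMoment volume coordinate u = ∫ y in (0 : ℝ)..1, stepLog u y := by
  have h := UnitAddCircle.intervalIntegral_preimage 0 (fun y : UnitAddCircle =>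
    Real.log ((coordinate y : ℝ) * Real.exp u + (1 - (coordinate y : ℝ)) * Real.exp (-u)))
  rw [logMoment, ← h, zero_add]
  refine intervalIntegral.integral_congr_ae ?_
  -- The coordinate of the circle point `1` is `0`, so this endpoint is discarded as a null set.
  filter_upwards [compl_mem_ae_iff.2 (measure_singleton (1 : ℝ))] with y hy1 hy
  rw [Set.uIoc_of_le zero_le_one] at hy
  rw [coordinate_coe, Int.fract_eq_self.2 ⟨hy.1.le, lt_of_le_of_ne hy.2 hy1⟩, stepLog]

/-- The argument of the logarithm is affine in `y` with slope `2 sinh u`, running from `e^(-u)` to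
`e^u`. -/
theorem integral_stepLog {u : ℝ} (hu : u ≠ 0) :
    ∫ y in (0 : ℝ)..1, stepLog u y = u * Real.cosh u / Real.sinh u - 1 := by
  have hs : Real.sinh u ≠ 0 := by simpa using hu
  have h : ∀ y : ℝ, stepLog u y = Real.log (2 * Real.sinh u * y + Real.exp (-u)) := by
    intro y
    rw [stepLog, Real.sinh_eq]
    congr 1
    ring
  simp_rw [h]
  rw [intervalIntegral.integral_comp_mul_add _ (mul_ne_zero two_ne_zero hs), integral_log]
  have h1 : 2 * Real.sinh u * 1 + Real.exp (-u) = Real.exp u := by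
    rw [Real.sinh_eq]
    ring
  rw [h1, mul_zero, zero_add, Real.log_exp, Real.log_exp, smul_eq_mul]
  rw [← mul_left_inj' hs]
  field_simp
  rw [Real.sinh_eq, Real.cosh_eq]
  ring

@[simp]
theorem logMoment_coordinate_zero : logMoment volume coordinate 0 = 0 := by
  simp [logMoment]

/-- The difference between `Λ` and its second order Taylor polynomial at `0`. -/
noncomputable def logMomentDefect (u : ℝ) : ℝ := u ^ 2 / 3 - logMoment volume coordinate u

@[simp]
theorem logMomentDefect_zero : logMomentDefect 0 = 0 := by simp [logMomentDefect]

theorem logMomentDefect_eq_cothDefect {u : ℝ} (hu : u ≠ 0) :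
    logMomentDefect u = cothDefect u := by
  rw [logMomentDefect, logMoment_coordinate_eq_integral, integral_stepLog hu, cothDefect]
  ring

theorem logMomentDefect_nonneg (u : ℝ) : 0 ≤ logMomentDefect u := by
  rcases eq_or_ne u 0 with rfl | hu
  · simp
  · rw [logMomentDefect_eq_cothDefect hu]
    exact cothDefect_nonneg hu

theorem exists_logMomentDefect_lower_bound :
    ∃ c : ℝ, 0 < c ∧ ∀ u : ℝ, c * min (u ^ 4) (u ^ 2) ≤ logMomentDefect u := by
  obtain ⟨c, hc, h⟩ := exists_cothDefect_lower_bound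
  refine ⟨c, hc, fun u => ?_⟩
  rcases eq_or_ne u 0 with rfl | hu
  · simp
  · rw [logMomentDefect_eq_cothDefect hu]
    exact h u hu

theorem tendsto_logMomentDefect_div_pow_four :
    Tendsto (fun u => logMomentDefect u / u ^ 4) (𝓝[≠] 0) (𝓝 (1 / 45)) := by
  refine tendsto_cothDefect_div_pow_four.congr' ?_
  filter_upwards [self_mem_nhdsWithin] with u hu
  rw [logMomentDefect_eq_cothDefect hu]

theorem freeEnergy_coordinate (β J s : ℝ) :
    freeEnergy volume coordinate β J s =
      (β * J / 2 - (β * J) ^ 2 / 3) * s ^ 2 + logMomentDefect (β * J * s) := by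
  rw [freeEnergy, logMomentDefect]
  ring

/-- In the variable `u = B s` the free energy is `-(1/3 - 1/(2B)) u²` plus a defect of order `u⁴`,
so a small `u ≠ 0` works. -/
theorem exists_freeEnergy_neg {β J : ℝ} (h : 3 / 2 < β * J) :
    ∃ s, freeEnergy volume coordinate β J s < 0 := by
  set B := β * J with hB
  have hB0 : 0 < B := by linarith
  have hlim : Tendsto (fun u => u ^ 2 * (logMomentDefect u / u ^ 4)) (𝓝[≠] 0) (𝓝 0) := by
    have h2 : Tendsto (fun u : ℝ => u ^ 2) (𝓝[≠] 0) (𝓝 0) := by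
      have := ((continuous_pow 2).tendsto (0 : ℝ)).mono_left (nhdsWithin_le_nhds (s := {0}ᶜ))
      simpa using this
    simpa using h2.mul tendsto_logMomentDefect_div_pow_four
  have hpos : 0 < 1 / 3 - 1 / (2 * B) := by
    rw [sub_pos, div_lt_div_iff₀ (by positivity) (by norm_num)]
    linarith
  obtain ⟨u, hu, hu0⟩ := ((hlim.eventually (gt_mem_nhds hpos)).and self_mem_nhdsWithin).exists
  have hu0 : u ≠ 0 := hu0
  refine ⟨u / B, ?_⟩
  rw [freeEnergy_coordinate, ← hB, mul_div_cancel₀ _ hB0.ne']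
  have h1 : u ^ 2 * (logMomentDefect u / u ^ 4) = logMomentDefect u / u ^ 2 := by
    field_simp
  rw [h1, div_lt_iff₀ (by positivity)] at hu
  have h2 : (B / 2 - B ^ 2 / 3) * (u / B) ^ 2 = -((1 / 3 - 1 / (2 * B)) * u ^ 2) := by
    field_simp
    ring
  linarith

theorem criticalBeta_coordinate {J : ℝ} (hJ : 0 < J) :
    criticalBeta (volume : Measure UnitAddCircle) coordinate J = 3 / (2 * J) := by
  have hset : {β : ℝ | 0 < β ∧ ∀ s : ℝ, 0 ≤ freeEnergy volume coordinate β J s}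
      = Set.Ioc 0 (3 / (2 * J)) := by
    ext β
    simp only [Set.mem_ofPred_eq, Set.mem_Ioc, and_congr_right_iff]
    intro hβ
    rw [le_div_iff₀ (by positivity)]
    constructor
    · intro h
      by_contra! hlt
      obtain ⟨s, hs⟩ := exists_freeEnergy_neg (β := β) (J := J) (by linarith)
      exact absurd (h s) (not_le.2 hs)
    · intro h s
      rw [freeEnergy_coordinate]
      refine add_nonneg (mul_nonneg ?_ (sq_nonneg s)) (logMomentDefect_nonneg _)
      have := mul_pos hβ hJ
      nlinarith
  rw [criticalBeta, hset, csSup_Ioc (by positivity)]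

/-! ### Discrepancy of ergodic sums of monotone functions along a rotation. -/

section Discrepancy

/-- Multiplication by `p` permutes the residues modulo `q`, and translation does too. -/
theorem sum_range_affine_emod {p k : ℤ} {q : ℕ} (hq : 0 < q) (hpq : IsCoprime p (q : ℤ))
    (F : ℕ → ℝ) :
    ∑ i ∈ Finset.range q, F ((k + ((i : ℤ) + 1) * p) % q).toNat
      = ∑ j ∈ Finset.range q, F j := by
  have hq' : (0 : ℤ) < q := by exact_mod_cast hq
  set g : ℕ → ℕ := fun i => ((k + ((i : ℤ) + 1) * p) % q).toNat with hg
  have hg_cast : ∀ i, ((g i : ℕ) : ℤ) = (k + ((i : ℤ) + 1) * p) % q := fun i =>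
    Int.toNat_of_nonneg (Int.emod_nonneg _ hq'.ne')
  have hinj : Set.InjOn g (Finset.range q) := by
    intro i hi i' hi' h
    simp only [Finset.coe_range, Set.mem_Iio] at hi hi'
    have h1 : (k + ((i : ℤ) + 1) * p) % q = (k + ((i' : ℤ) + 1) * p) % q := by
      rw [← hg_cast, ← hg_cast, h]
    have h2 : (q : ℤ) ∣ ((i' : ℤ) - i) * p := by
      have := Int.ModEq.dvd h1
      rwa [show k + ((i' : ℤ) + 1) * p - (k + ((i : ℤ) + 1) * p) = ((i' : ℤ) - i) * p by ring]
        at this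
    have h3 : (q : ℤ) ∣ (i' : ℤ) - i := hpq.symm.dvd_of_dvd_mul_right h2
    have h4 : (i' : ℤ) - i = 0 := by
      refine Int.eq_zero_of_abs_lt_dvd h3 ?_
      rw [abs_lt]
      constructor <;> omega
    omega
  have himage : (Finset.range q).image g = Finset.range q := by
    refine Finset.eq_of_subset_of_card_le ?_ ?_
    · intro j hj
      obtain ⟨i, -, rfl⟩ := Finset.mem_image.1 hj
      rw [Finset.mem_range]
      have h1 := hg_cast i
      have h2 := Int.emod_lt_of_pos (k + ((i : ℤ) + 1) * p) hq'
      omega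
    · rw [Finset.card_image_of_injOn hinj]
  conv_rhs => rw [← himage]
  rw [Finset.sum_image hinj]

/-- **Denjoy–Koksma inequality** for monotone functions: along `q` steps of a rotation by `α`,
where `p / q` is a reduced fraction with `|α - p / q| < 1 / q²`, the ergodic sums of a monotone
function deviate from their mean by at most three times its variation. -/
theorem denjoy_koksma {h : ℝ → ℝ} (hm : MonotoneOn h (Set.Icc 0 1)) {α : ℝ} (x : ℝ) {p : ℤ}
    {q : ℕ} (hq : 0 < q) (hpq : IsCoprime p (q : ℤ)) (happ : |q * α - p| < 1 / q) :
    |∑ i ∈ Finset.range q, h (Int.fract (x + (i + 1) * α)) - q * ∫ y in (0 : ℝ)..1, h y|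
      ≤ 3 * (h 1 - h 0) := by
  have hq' : (0 : ℝ) < q := by exact_mod_cast hq
  have hqz : (0 : ℤ) < q := by exact_mod_cast hq
  have hmem : ∀ j : ℕ, min ((j : ℝ) / q) 1 ∈ Set.Icc (0 : ℝ) 1 := fun j =>
    ⟨le_min (by positivity) zero_le_one, min_le_right _ _⟩
  -- The clamp at `1` gives a meaning to the indices above `q` that the shift `j + 2` produces.
  set H : ℕ → ℝ := fun j => h (min ((j : ℝ) / q) 1) with hH
  have hHmono : Monotone H := by
    intro a b hab
    refine hm (hmem a) (hmem b) (min_le_min_right _ ?_)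
    gcongr
  have hH0 : ∀ j, h 0 ≤ H j := fun j =>
    hm (Set.left_mem_Icc.2 zero_le_one) (hmem j) (hmem j).1
  have hH1 : ∀ j, H j ≤ h 1 := fun j =>
    hm (hmem j) (Set.right_mem_Icc.2 zero_le_one) (hmem j).2
  have hHle : ∀ j : ℕ, j ≤ q → H j = h ((j : ℝ) / q) := by
    intro j hj
    simp only [hH]
    rw [min_eq_left]
    rw [div_le_one hq']
    exact_mod_cast hj
  have hV : 0 ≤ h 1 - h 0 :=
    sub_nonneg.2 (hm (Set.left_mem_Icc.2 zero_le_one) (Set.right_mem_Icc.2 zero_le_one)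
      zero_le_one)
  -- comparison of the integral with Riemann sums
  have hscale : q * ∫ y in (0 : ℝ)..1, h y = ∫ t in (0 : ℝ)..0 + (q : ℕ), h (t / q) := by
    rw [intervalIntegral.integral_comp_div _ hq'.ne', smul_eq_mul, zero_div, zero_add,
      div_self hq'.ne']
  have hmono' : MonotoneOn (fun t : ℝ => h (t / q)) (Set.Icc 0 (0 + (q : ℕ))) := by
    intro a ha b hb hab
    rw [zero_add] at ha hb
    refine hm ⟨div_nonneg ha.1 hq'.le, (div_le_one hq').2 ha.2⟩
      ⟨div_nonneg hb.1 hq'.le, (div_le_one hq').2 hb.2⟩ ?_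
    gcongr
  have hint_ge : ∑ j ∈ Finset.range q, H j ≤ q * ∫ y in (0 : ℝ)..1, h y := by
    rw [hscale]
    refine le_trans (le_of_eq ?_) hmono'.sum_le_integral
    refine Finset.sum_congr rfl fun j hj => ?_
    rw [hHle j (Finset.mem_range.1 hj).le, zero_add]
  have hint_le : q * ∫ y in (0 : ℝ)..1, h y ≤ ∑ j ∈ Finset.range q, H (j + 1) := by
    rw [hscale]
    refine le_trans hmono'.integral_le_sum (le_of_eq ?_)
    refine Finset.sum_congr rfl fun j hj => ?_
    rw [hHle (j + 1) (Finset.mem_range.1 hj), zero_add]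
  -- location of the points of the orbit
  set k : ℤ := ⌊(q : ℝ) * x⌋ with hk
  set g : ℕ → ℕ := fun i => ((k + ((i : ℤ) + 1) * p) % q).toNat with hg
  -- Up to a multiple of `q`, the scaled orbit point `q v` differs from the integer `g i` by an
  -- error in `(-1, 2)`. So `v` lies between the grid points `g i - 1` and `g i + 2`, unless it
  -- wraps around the circle. Wrapping can spoil the upper bound only for `g i = 0` and the lower
  -- one only for `g i = q - 1`; each of these single points is charged the full variation. The
  -- natural subtraction `g i - 1` truncates to `0`, which is harmless.
  have hpoint : ∀ i ∈ Finset.range q,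
      h (Int.fract (x + (i + 1) * α)) ≤ H (g i + 2) + (if g i = 0 then h 1 - h 0 else 0) ∧
      H (g i - 1) - (if g i = q - 1 then h 1 - h 0 else 0)
        ≤ h (Int.fract (x + (i + 1) * α)) := by
    intro i hi
    have hi : i + 1 ≤ q := Finset.mem_range.1 hi
    have hgz : ((g i : ℕ) : ℤ) = (k + ((i : ℤ) + 1) * p) % q :=
      Int.toNat_of_nonneg (Int.emod_nonneg _ hqz.ne')
    have hglt : g i < q := by
      have := Int.emod_lt_of_pos (k + ((i : ℤ) + 1) * p) hqz
      omega
    set v := Int.fract (x + (i + 1) * α) with hv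
    have hv0 : 0 ≤ v := Int.fract_nonneg _
    have hv1 : v < 1 := Int.fract_lt_one _
    have hvmem : v ∈ Set.Icc (0 : ℝ) 1 := ⟨hv0, hv1.le⟩
    have hhv0 : h 0 ≤ h v := hm (Set.left_mem_Icc.2 zero_le_one) hvmem hv0
    have hhv1 : h v ≤ h 1 := hm hvmem (Set.right_mem_Icc.2 zero_le_one) hv1.le
    -- The error is the fractional part of `q x`, in `[0, 1)`, plus a drift smaller than `1` in
    -- absolute value because `i + 1 ≤ q`.
    obtain ⟨l, hl⟩ : ∃ l : ℤ, q * v - (g i : ℝ) - l * q = q * x - k + (i + 1) * (q * α - p) := by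
      refine ⟨(k + ((i : ℤ) + 1) * p) / q - ⌊x + (i + 1) * α⌋, ?_⟩
      have h1 : ((g i : ℕ) : ℝ) + q * (((k + ((i : ℤ) + 1) * p) / q : ℤ) : ℝ)
          = k + ((i : ℝ) + 1) * p := by
        have := Int.emod_add_mul_ediv (k + ((i : ℤ) + 1) * p) q
        rw [← hgz] at this
        exact_mod_cast this
      rw [hv, Int.fract]
      push_cast
      linarith
    have hx0 : 0 ≤ q * x - k := sub_nonneg.2 (Int.floor_le _)
    have hx1 : q * x - k < 1 := by linarith [Int.lt_floor_add_one ((q : ℝ) * x)]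
    have hθ : |((i : ℝ) + 1) * (q * α - p)| < 1 := by
      have hi' : ((i : ℝ) + 1) ≤ q := by exact_mod_cast hi
      rw [abs_mul, abs_of_pos (by positivity : (0 : ℝ) < (i : ℝ) + 1)]
      calc ((i : ℝ) + 1) * |q * α - p| < ((i : ℝ) + 1) * (1 / q) := by gcongr
        _ ≤ q * (1 / q) := by gcongr
        _ = 1 := by field_simp
    rw [abs_lt] at hθ
    have hqv : q * v < q := by nlinarith
    have hqv0 : 0 ≤ q * v := by positivity
    constructor
    · split_ifs with h0
      · linarith [hH0 (g i + 2)]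
      · have hl0 : l ≤ 0 := by
          by_contra! hl1
          have h1 : (1 : ℝ) ≤ l := by exact_mod_cast hl1
          have h2 : (1 : ℝ) ≤ g i := by exact_mod_cast Nat.one_le_iff_ne_zero.2 h0
          nlinarith
        have h1 : (l : ℝ) ≤ 0 := by exact_mod_cast hl0
        rw [add_zero]
        refine hm hvmem (hmem _) (le_min ?_ hv1.le)
        rw [le_div_iff₀ hq']
        push_cast
        nlinarith
    · split_ifs with h0
      · linarith [hH1 (g i - 1)]
      · have hl0 : 0 ≤ l := by
          by_contra! hl1
          have h1 : (l : ℝ) ≤ -1 := by exact_mod_cast Int.le_sub_one_of_lt hl1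
          have h2 : (g i : ℝ) + 2 ≤ q := by exact_mod_cast (by omega : g i + 2 ≤ q)
          nlinarith
        have h1 : (0 : ℝ) ≤ l := by exact_mod_cast hl0
        rw [sub_zero]
        refine hm (hmem _) hvmem ((min_le_left _ _).trans ?_)
        rw [div_le_iff₀ hq']
        rcases Nat.eq_zero_or_pos (g i) with h2 | h2
        · rw [h2]
          simpa [mul_comm] using hqv0
        · rw [Nat.cast_sub h2]
          push_cast
          nlinarith
  have hup : ∑ i ∈ Finset.range q, h (Int.fract (x + (i + 1) * α))
      ≤ ∑ j ∈ Finset.range q, H (j + 2) + (h 1 - h 0) := by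
    refine (Finset.sum_le_sum fun i hi => (hpoint i hi).1).trans ?_
    rw [sum_range_affine_emod hq hpq
      (fun j => H (j + 2) + (if j = 0 then h 1 - h 0 else 0)), Finset.sum_add_distrib,
      Finset.sum_ite_eq' (Finset.range q) 0]
    simp [hq]
  have hlow : ∑ j ∈ Finset.range q, H (j - 1) - (h 1 - h 0)
      ≤ ∑ i ∈ Finset.range q, h (Int.fract (x + (i + 1) * α)) := by
    refine le_trans ?_ (Finset.sum_le_sum fun i hi => (hpoint i hi).2)
    rw [sum_range_affine_emod hq hpq
      (fun j => H (j - 1) - (if j = q - 1 then h 1 - h 0 else 0)), Finset.sum_sub_distrib,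
      Finset.sum_ite_eq' (Finset.range q) (q - 1)]
    simp [hq]
  -- A shift of the index by two telescopes to at most two variations; the exceptional point
  -- contributes the third.
  have htel_up : ∑ j ∈ Finset.range q, H (j + 2) - ∑ j ∈ Finset.range q, H j
      ≤ 2 * (h 1 - h 0) := by
    have := Finset.sum_range_sub (fun j => H j + H (j + 1)) q
    rw [← Finset.sum_sub_distrib, Finset.sum_congr rfl fun j _ =>
      (by ring : H (j + 2) - H j = H (j + 1) + H (j + 1 + 1) - (H j + H (j + 1))), this]
    linarith [hH1 q, hH1 (q + 1), hH0 0, hH0 (0 + 1)]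
  have htel_low : ∑ j ∈ Finset.range q, H (j + 1) - ∑ j ∈ Finset.range q, H (j - 1)
      ≤ 2 * (h 1 - h 0) := by
    have := Finset.sum_range_sub (fun j => H j + H (j - 1)) q
    rw [← Finset.sum_sub_distrib, Finset.sum_congr rfl fun j _ =>
      (by rw [Nat.add_sub_cancel]; ring :
        H (j + 1) - H (j - 1) = H (j + 1) + H (j + 1 - 1) - (H j + H (j - 1))), this]
    linarith [hH1 q, hH1 (q - 1), hH0 0, hH0 (0 - 1)]
  rw [abs_le]
  constructor <;> linarith

/-- The deviation of an ergodic sum of the rotation by `α` from its mean. -/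
noncomputable def rotationDeviation (h : ℝ → ℝ) (α : ℝ) (n : ℕ) (x : ℝ) : ℝ :=
  ∑ i ∈ Finset.range n, h (Int.fract (x + (i + 1) * α)) - n * ∫ y in (0 : ℝ)..1, h y

theorem rotationDeviation_add (h : ℝ → ℝ) (α : ℝ) (m n : ℕ) (x : ℝ) :
    rotationDeviation h α (m + n) x
      = rotationDeviation h α m x + rotationDeviation h α n (x + m * α) := by
  simp only [rotationDeviation, Finset.sum_range_add]
  have : ∀ i : ℕ, x + (((m + i : ℕ) : ℝ) + 1) * α = x + m * α + (i + 1) * α := by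
    intro i
    push_cast
    ring
  simp_rw [this]
  push_cast
  ring

/-- Uniformity in the starting point is essential: each block of length `q` starts elsewhere on the
circle. -/
theorem abs_rotationDeviation_mul_le {h : ℝ → ℝ} {α C : ℝ} {q : ℕ}
    (hq : ∀ x, |rotationDeviation h α q x| ≤ C) (b : ℕ) (x : ℝ) :
    |rotationDeviation h α (q * b) x| ≤ C * b := by
  induction b with
  | zero => simp [rotationDeviation]
  | succ b ih =>
    rw [Nat.mul_succ, rotationDeviation_add]
    refine (abs_add_le _ _).trans ((add_le_add ih (hq _)).trans (le_of_eq ?_))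
    push_cast
    ring

/-- If `‖kα‖ ≥ c |k|^(-σ)` then the ergodic sums of monotone functions over `n` steps of the
rotation by `α` deviate from their means by `O(n^(1 - 1/σ))`. -/
theorem exists_rotationDeviation_le {α σ c : ℝ} (hσ : 1 < σ) (hc : 0 < c)
    (hα : ∀ k : ℤ, k ≠ 0 → c ≤ (max 1 |(k : ℝ)|) ^ σ * |k * α - round (k * α)|) :
    ∃ A : ℝ, ∀ h : ℝ → ℝ, MonotoneOn h (Set.Icc 0 1) → ∀ (n : ℕ) (x : ℝ),
      |rotationDeviation h α n x| ≤ A * (h 1 - h 0) * (n : ℝ) ^ (1 - 1 / σ) := by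
  set γ := 1 - 1 / σ with hγ
  have hσ0 : 0 < σ := by linarith
  have hγ0 : 0 < γ := by
    rw [hγ, sub_pos, div_lt_one hσ0]
    exact hσ
  set K := 3 * (1 / c) ^ (1 / σ) with hK
  have hK0 : 0 ≤ K := by positivity
  set ρ := ((1 : ℝ) / 2) ^ γ with hρ
  have hρ1 : ρ < 1 := Real.rpow_lt_one (by norm_num) (by norm_num) hγ0
  -- The constant `K / (1 - ρ)` is the fixed point of `A = K + A ρ`: dividing `n` by a denominator
  -- `q`, the full blocks cost `K n^γ`, and the remainder, at most `n / 2`, costs `A ρ n^γ` by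
  -- induction.
  have hA : K + K / (1 - ρ) * ρ = K / (1 - ρ) := by
    have : 1 - ρ ≠ 0 := by linarith
    field_simp
    ring
  have hA0 : 0 ≤ K / (1 - ρ) := div_nonneg hK0 (by linarith)
  refine ⟨K / (1 - ρ), fun h hm n => ?_⟩
  have hV : 0 ≤ h 1 - h 0 :=
    sub_nonneg.2 (hm (Set.left_mem_Icc.2 zero_le_one) (Set.right_mem_Icc.2 zero_le_one)
      zero_le_one)
  induction n using Nat.strong_induction_on with
  | _ n ih =>
  intro x
  rcases Nat.eq_zero_or_pos n with rfl | hn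
  · simp only [rotationDeviation, Finset.range_zero, Finset.sum_empty, Nat.cast_zero, zero_mul,
      sub_zero, abs_zero]
    positivity
  have hn' : (0 : ℝ) < n := by exact_mod_cast hn
  -- Dirichlet's theorem at level `n` gives `q ≤ n` with `|q α - p| ≤ 1 / (n + 1)`. This is close
  -- enough for Denjoy–Koksma and, against the Diophantine bound, forces `q` to be at least of order
  -- `n^(1/σ)`.
  obtain ⟨r, hr, hrn⟩ := Real.exists_rat_abs_sub_le_and_den_le α hn
  have hq : 0 < r.den := r.pos
  have hq' : (0 : ℝ) < r.den := by exact_mod_cast hq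
  have hrn' : (r.den : ℝ) ≤ n := by exact_mod_cast hrn
  have happ : |r.den * α - r.num| ≤ 1 / (n + 1) := by
    have h1 : r.den * α - r.num = r.den * (α - r) := by
      rw [Rat.cast_def r]
      field_simp
    rw [h1, abs_mul, abs_of_pos hq']
    refine (mul_le_mul_of_nonneg_left hr hq'.le).trans (le_of_eq ?_)
    field_simp
  have happ' : |r.den * α - r.num| < 1 / r.den := by
    refine happ.trans_lt (one_div_lt_one_div_of_lt hq' ?_)
    linarith
  have hcop : IsCoprime r.num (r.den : ℤ) := by
    rw [Int.isCoprime_iff_gcd_eq_one]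
    simpa [Int.gcd] using r.reduced
  have hDK : ∀ x, |rotationDeviation h α r.den x| ≤ 3 * (h 1 - h 0) := fun x =>
    denjoy_koksma hm x hq hcop happ'
  -- the denominator is large
  have hden : c * n ≤ (r.den : ℝ) ^ σ := by
    have h1 := hα r.den (by exact_mod_cast hq.ne')
    have h2 : (1 : ℝ) ≤ r.den := by exact_mod_cast hq
    have h3 := (round_le ((r.den : ℝ) * α) r.num).trans happ
    push_cast at h1
    rw [abs_of_pos hq', max_eq_right h2] at h1
    have h4 : c ≤ (r.den : ℝ) ^ σ * (1 / (n + 1)) :=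
      h1.trans (mul_le_mul_of_nonneg_left h3 (by positivity))
    rw [mul_one_div, le_div_iff₀ (by positivity)] at h4
    nlinarith
  have hblocks : ((n / r.den : ℕ) : ℝ) ≤ (1 / c) ^ (1 / σ) * (n : ℝ) ^ γ := by
    refine Nat.cast_div_le.trans ?_
    rw [div_le_iff₀ hq']
    have h1 : (c * n) ^ (1 / σ) ≤ r.den := by
      have := Real.rpow_le_rpow (by positivity) hden (by positivity : 0 ≤ 1 / σ)
      rwa [← Real.rpow_mul hq'.le, mul_one_div_cancel hσ0.ne', Real.rpow_one] at this
    have h2 : (1 / c) ^ (1 / σ) * (n : ℝ) ^ γ * (c * n) ^ (1 / σ) = n := by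
      rw [Real.mul_rpow hc.le hn'.le]
      have h3 : (1 / c) ^ (1 / σ) * c ^ (1 / σ) = 1 := by
        rw [← Real.mul_rpow (by positivity) hc.le, one_div_mul_cancel hc.ne', Real.one_rpow]
      have h4 : (n : ℝ) ^ γ * (n : ℝ) ^ (1 / σ) = n := by
        rw [← Real.rpow_add hn', hγ, sub_add_cancel, Real.rpow_one]
      calc _ = ((1 / c) ^ (1 / σ) * c ^ (1 / σ)) * ((n : ℝ) ^ γ * (n : ℝ) ^ (1 / σ)) := by ring
        _ = n := by rw [h3, h4, one_mul]
    calc (n : ℝ) = (1 / c) ^ (1 / σ) * (n : ℝ) ^ γ * (c * n) ^ (1 / σ) := h2.symm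
      _ ≤ _ := by gcongr
  have hmod : (((n % r.den : ℕ) : ℝ)) ^ γ ≤ ρ * (n : ℝ) ^ γ := by
    rw [hρ, ← Real.mul_rpow (by norm_num) hn'.le]
    refine Real.rpow_le_rpow (by positivity) ?_ hγ0.le
    have h1 : 2 * (n % r.den) ≤ n := by
      have h2 := Nat.mod_lt n hq
      have h3 := Nat.mod_add_div n r.den
      have h4 : r.den * 1 ≤ r.den * (n / r.den) :=
        Nat.mul_le_mul_left _ ((Nat.one_le_div_iff hq).2 hrn)
      omega
    have : (2 : ℝ) * ((n % r.den : ℕ) : ℝ) ≤ n := by exact_mod_cast h1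
    linarith
  have hih := ih (n % r.den) ((Nat.mod_lt n hq).trans_le hrn)
    (x + ((r.den * (n / r.den) : ℕ) : ℝ) * α)
  have hsplit : rotationDeviation h α n x = rotationDeviation h α (r.den * (n / r.den)) x
      + rotationDeviation h α (n % r.den) (x + ((r.den * (n / r.den) : ℕ) : ℝ) * α) := by
    rw [← rotationDeviation_add, Nat.div_add_mod]
  rw [hsplit]
  calc _ ≤ 3 * (h 1 - h 0) * ((n / r.den : ℕ) : ℝ)
        + K / (1 - ρ) * (h 1 - h 0) * ((n % r.den : ℕ) : ℝ) ^ γ :=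
        (abs_add_le _ _).trans (add_le_add (abs_rotationDeviation_mul_le hDK _ _) hih)
    _ ≤ 3 * (h 1 - h 0) * ((1 / c) ^ (1 / σ) * (n : ℝ) ^ γ)
        + K / (1 - ρ) * (h 1 - h 0) * (ρ * (n : ℝ) ^ γ) := by gcongr
    _ = (K + K / (1 - ρ) * ρ) * (h 1 - h 0) * (n : ℝ) ^ γ := by rw [hK]; ring
    _ = _ := by rw [hA]

/-- Admissible exponents can be raised, as `max 1 |k| ≥ 1`. Exceeding `1` makes the discrepancy
exponent `1 - 1/σ` positive. -/
theorem HasType.exists_exponent {α η τ : ℝ} (h : HasType α η) (hτ : η < τ) (h1 : 1 < τ) :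
    ∃ σ c : ℝ, 1 < σ ∧ σ < τ ∧ 0 < c ∧
      ∀ k : ℤ, k ≠ 0 → c ≤ (max 1 |(k : ℝ)|) ^ σ * |k * α - round (k * α)| := by
  obtain ⟨σ, ⟨c, hc, hσ⟩, hστ⟩ := (isGLB_lt_iff h).1 hτ
  obtain ⟨σ', h2, h3⟩ := exists_between (max_lt hστ h1)
  refine ⟨σ', c, (le_max_right _ _).trans_lt h2, h3, hc, fun k hk => (hσ k hk).trans ?_⟩
  gcongr
  · exact le_max_left _ _
  · exact (le_max_left _ _).trans h2.le

/-- For `α` of type less than `1 / (1 - κ)` the ergodic sums of `stepLog u` along the rotation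
by `α` deviate from their means by `O(|u| n^γ)` for some `γ < κ`, uniformly in `u`. -/
theorem HasType.exists_stepLog_deviation_le {α η κ : ℝ} (h : HasType α η) (hκ0 : 0 < κ)
    (hκ1 : κ < 1) (hκ : η < 1 / (1 - κ)) :
    ∃ A γ : ℝ, γ < κ ∧ ∀ (u : ℝ) (n : ℕ) (x : ℝ),
      |rotationDeviation (stepLog u) α n x| ≤ A * |u| * (n : ℝ) ^ γ := by
  have hκ2 : 0 < 1 - κ := by linarith
  obtain ⟨σ, c, hσ, hσκ, hc, hα⟩ := h.exists_exponent hκ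
    (by rw [lt_div_iff₀ hκ2]; linarith)
  obtain ⟨A, hA⟩ := exists_rotationDeviation_le hσ hc hα
  have hσ0 : 0 < σ := by linarith
  -- The factor `2` arises because `stepLog u` runs between `-u` and `u`; for `u ≤ 0` the bound is
  -- applied to its negative.
  refine ⟨2 * A, 1 - 1 / σ, ?_, fun u n x => ?_⟩
  · rw [lt_div_iff₀ hκ2] at hσκ
    have : 1 - κ < 1 / σ := by
      rw [lt_div_iff₀ hσ0]
      linarith
    linarith
  · rcases le_total 0 u with hu | hu
    · refine (hA _ (stepLog_monotoneOn hu) n x).trans (le_of_eq ?_)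
      rw [stepLog_apply_one, stepLog_apply_zero, abs_of_nonneg hu]
      ring
    · have h1 := hA _ (stepLog_antitoneOn hu).neg n x
      have h2 : rotationDeviation (fun y => -stepLog u y) α n x = -rotationDeviation (stepLog u) α n x := by
        simp only [rotationDeviation, Finset.sum_neg_distrib,
          intervalIntegral.integral_neg]
        ring
      rw [h2, abs_neg] at h1
      refine h1.trans (le_of_eq ?_)
      rw [stepLog_apply_one, stepLog_apply_zero, abs_of_nonpos hu]
      ring

end Discrepancy

/-! ### Linearizing the interaction by a Gaussian integral. -/

section HubbardStratonovich

theorem rotation_iterate_coe (α x : ℝ) (k : ℕ) :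
    (rotation α)^[k] (x : UnitAddCircle) = ((x + k * α : ℝ) : UnitAddCircle) := by
  induction k with
  | zero => simp
  | succ k ih =>
    rw [Function.iterate_succ_apply', ih, rotation, ← AddCircle.coe_add]
    congr 1
    push_cast
    ring

theorem coordinate_rotation_iterate (α x : ℝ) (k : ℕ) :
    (coordinate ((rotation α)^[k + 1] (x : UnitAddCircle)) : ℝ)
      = Int.fract (x + (k + 1) * α) := by
  rw [rotation_iterate_coe, coordinate_coe]
  push_cast
  rfl

theorem sum_prod_stepProb_mul_exp {n : ℕ} (p : Fin n → ℝ) (u : ℝ) :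
    ∑ σ : Fin n → ℤˣ, (∏ i, stepProb (p i) (σ i)) * Real.exp (u * magnetization σ)
      = ∏ i, (p i * Real.exp u + (1 - p i) * Real.exp (-u)) := by
  have h1 : ∀ σ : Fin n → ℤˣ,
      (∏ i, stepProb (p i) (σ i)) * Real.exp (u * magnetization σ)
        = ∏ i, stepProb (p i) (σ i) * Real.exp (u * ((σ i : ℤ) : ℝ)) := by
    intro σ
    rw [Finset.prod_mul_distrib, magnetization, Finset.mul_sum, Real.exp_sum]
  simp_rw [h1]
  rw [← Fintype.prod_sum fun i (s : ℤˣ) => stepProb (p i) s * Real.exp (u * ((s : ℤ) : ℝ))]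
  refine Finset.prod_congr rfl fun i _ => ?_
  have huniv : (Finset.univ : Finset ℤˣ) = {1, -1} := by decide
  have hne : (-1 : ℤˣ) ≠ 1 := by decide
  rw [huniv, Finset.sum_pair hne.symm]
  simp [stepProb, hne]

/-- The energy `n G_n(s)`, where
`G_n(s) = B s² / 2 - (1/n) ∑ log (f(T^i x) e^{B s} + (1 - f(T^i x)) e^{-B s})`. -/
noncomputable def orbitEnergy (B α x : ℝ) (n : ℕ) (s : ℝ) : ℝ :=
  n * (B / 2 * s ^ 2) - ∑ i ∈ Finset.range n, stepLog (B * s) (Int.fract (x + (i + 1) * α))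

theorem continuous_stepLog_left {y : ℝ} (hy : y ∈ Set.Icc (0 : ℝ) 1) :
    Continuous fun u => stepLog u y :=
  Continuous.log (by fun_prop) fun u => (step_mgf_pos u hy).ne'

theorem fract_mem_Icc (y : ℝ) : Int.fract y ∈ Set.Icc (0 : ℝ) 1 :=
  ⟨Int.fract_nonneg y, (Int.fract_lt_one y).le⟩

theorem continuous_orbitEnergy (B α x : ℝ) (n : ℕ) : Continuous (orbitEnergy B α x n) := by
  refine Continuous.sub (by fun_prop) (continuous_finsetSum _ fun i _ => ?_)
  exact (continuous_stepLog_left (fract_mem_Icc _)).comp (by fun_prop)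

theorem orbitEnergy_eq (β J α x : ℝ) (n : ℕ) (s : ℝ) :
    orbitEnergy (β * J) α x n s = n * freeEnergy volume coordinate β J s
      - rotationDeviation (stepLog (β * J * s)) α n x := by
  rw [orbitEnergy, rotationDeviation, freeEnergy, logMoment_coordinate_eq_integral]
  ring

/-- Independence of the steps factors the moment generating function. Read backwards, this exhibits
the density as a finite mixture of Gaussians in `s`, each with an explicit Fourier transform. -/
theorem exp_neg_orbitEnergy (B α x : ℝ) (n : ℕ) (s : ℝ) :
    Real.exp (-orbitEnergy B α x n s)
      = Real.exp (-(n * (B / 2 * s ^ 2))) * ∑ σ : Fin n → ℤˣ,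
          (∏ i : Fin n, stepProb (coordinate ((rotation α)^[(i : ℕ) + 1] (x : UnitAddCircle)))
            (σ i)) * Real.exp (B * s * magnetization σ) := by
  rw [sum_prod_stepProb_mul_exp, orbitEnergy, neg_sub, sub_eq_add_neg, add_comm, Real.exp_add,
    Real.exp_sum]
  congr 1
  rw [← Fin.prod_univ_eq_prod_range
    (fun i => Real.exp (stepLog (B * s) (Int.fract (x + ((i : ℕ) + 1) * α))))]
  refine Finset.prod_congr rfl fun i _ => ?_
  rw [coordinate_rotation_iterate, stepLog, Real.exp_log (step_mgf_pos _ (fract_mem_Icc _))]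

/-- The **Hubbard–Stratonovich transform**: the Fourier transform of `exp (-n G_n)` in terms of
the Gibbs weights. -/
theorem integral_exp_neg_orbitEnergy {β J : ℝ} (hB : 0 < β * J) (α x : ℝ) {n : ℕ} (hn : 0 < n)
    {r : ℝ} (hr : 0 < r) (t : ℝ) :
    ∫ y : ℝ, Complex.exp (t * y * Complex.I)
        * (Real.exp (-orbitEnergy (β * J) α x n (r * y)) : ℂ)
      = (Real.pi / (n * (β * J) * r ^ 2 / 2 : ℝ) : ℂ) ^ (1 / 2 : ℂ)
        * Complex.exp (-(t ^ 2 / (2 * (n * (β * J) * r ^ 2)) : ℝ))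
        * ∑ σ, (gibbsWeight (rotation α) coordinate β J (x : UnitAddCircle) n σ : ℂ)
          * Complex.exp ((t * (magnetization σ / (n * r)) : ℝ) * Complex.I) := by
  set B := β * J with hBdef
  have hn' : (0 : ℝ) < n := by exact_mod_cast hn
  have ha : 0 < n * B * r ^ 2 / 2 := by positivity
  set P : (Fin n → ℤˣ) → ℝ := fun σ => ∏ i : Fin n,
    stepProb (coordinate ((rotation α)^[(i : ℕ) + 1] (x : UnitAddCircle))) (σ i) with hP
  have hre : (-((n * B * r ^ 2 / 2 : ℝ) : ℂ)).re < 0 := by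
    rw [Complex.neg_re, Complex.ofReal_re]
    linarith
  have h1 : ∀ y : ℝ, Complex.exp (t * y * Complex.I)
        * (Real.exp (-orbitEnergy B α x n (r * y)) : ℂ)
      = ∑ σ, (P σ : ℂ) * Complex.exp (-((n * B * r ^ 2 / 2 : ℝ) : ℂ) * y ^ 2
          + ((B * r * magnetization σ : ℝ) + t * Complex.I) * y + 0) := by
    intro y
    rw [exp_neg_orbitEnergy]
    push_cast
    rw [Finset.mul_sum, Finset.mul_sum]
    refine Finset.sum_congr rfl fun σ _ => ?_
    have h2 : ∀ a b c d : ℂ, a * (b * (c * d)) = c * (a * b * d) := fun a b c d => by ring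
    rw [h2, ← Complex.exp_add, ← Complex.exp_add, hP]
    push_cast
    congr 2
    ring
  simp_rw [h1]
  rw [integral_finsetSum _ fun σ _ => (integrable_cexp_quadratic' hre _ _).const_mul _,
    Finset.mul_sum]
  refine Finset.sum_congr rfl fun σ _ => ?_
  rw [integral_const_mul, integral_cexp_quadratic hre, neg_neg, gibbsWeight]
  rw [show ∏ i : Fin n, stepProb (coordinate ((rotation α)^[(i : ℕ) + 1] (x : UnitAddCircle)))
    (σ i) = P σ from rfl]
  push_cast
  have hnC : (n : ℂ) ≠ 0 := by exact_mod_cast hn.ne'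
  have hrC : (r : ℂ) ≠ 0 := by exact_mod_cast hr.ne'
  have hBC : (B : ℂ) ≠ 0 := by exact_mod_cast hB.ne'
  -- Expanding the completed square recovers the interaction `B M² / (2n)`, the phase `t M / (n r)`
  -- and the Gaussian factor in `t`.
  have h3 : (0 : ℂ) - ((B : ℂ) * r * (magnetization σ : ℂ) + t * Complex.I) ^ 2
        / (4 * -((n : ℂ) * B * r ^ 2 / 2))
      = -((t : ℂ) ^ 2 / (2 * (n * B * r ^ 2)))
        + ((B : ℂ) / (2 * n) * (magnetization σ : ℂ) ^ 2
          + t * ((magnetization σ : ℂ) / (n * r)) * Complex.I) := by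
    field_simp
    ring_nf
    rw [Complex.I_sq]
    ring
  rw [h3, Complex.exp_add, Complex.exp_add]
  rw [hBdef]
  push_cast
  ring

instance : MeasurableSingletonClass ℤˣ where
  measurableSet_singleton u := by
    refine ⟨{(u : ℤ)}, measurableSet_singleton _, ?_⟩
    ext v
    simp [Units.ext_iff]

theorem integral_gibbsMeasure {E : Type*} (T : E → E) (f : E → unitInterval) (β J : ℝ) (x : E)
    (n : ℕ) (g : (Fin n → ℤˣ) → ℂ) :
    ∫ σ, g σ ∂(gibbsMeasure T f β J x n) = ∑ σ, (gibbsProb T f β J x n σ : ℂ) * g σ := by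
  rw [gibbsMeasure, integral_finsetSum_measure]
  · refine Finset.sum_congr rfl fun σ _ => ?_
    rw [integral_smul_measure, integral_dirac,
      ENNReal.toReal_ofReal (gibbsProb_nonneg T f β J x n σ), Complex.real_smul]
  · intro σ _
    exact (integrable_dirac (by finiteness)).smul_measure ENNReal.ofReal_ne_top

theorem charFun_map_gibbsMeasure {E : Type*} (T : E → E) (f : E → unitInterval) (β J : ℝ) (x : E)
    (n : ℕ) (X : (Fin n → ℤˣ) → ℝ) (t : ℝ) :
    charFun ((gibbsMeasure T f β J x n).map X) t
      = (∑ σ, (gibbsWeight T f β J x n σ : ℂ) * Complex.exp ((t * X σ : ℝ) * Complex.I))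
        / ∑ σ, (gibbsWeight T f β J x n σ : ℂ) := by
  rw [charFun_apply_real, integral_map (measurable_of_finite X).aemeasurable (by fun_prop),
    integral_gibbsMeasure, Finset.sum_div]
  refine Finset.sum_congr rfl fun σ _ => ?_
  rw [gibbsProb]
  push_cast
  ring

/-- Dividing the transform at `t` by its value at `0` cancels the Gaussian constant and supplies the
partition function; the prefactor removes the auxiliary Gaussian noise. -/
theorem charFun_magnetization {β J : ℝ} (hB : 0 < β * J) (α x : ℝ) {n : ℕ} (hn : 0 < n)
    {r : ℝ} (hr : 0 < r) (t : ℝ) :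
    charFun ((gibbsMeasure (rotation α) coordinate β J (x : UnitAddCircle) n).map
        fun σ => magnetization σ / (n * r)) t
      = Complex.exp ((t ^ 2 / (2 * (n * (β * J) * r ^ 2)) : ℝ))
        * ((∫ y : ℝ, Complex.exp (t * y * Complex.I)
            * (Real.exp (-orbitEnergy (β * J) α x n (r * y)) : ℂ))
          / ∫ y : ℝ, Complex.exp ((0 : ℝ) * y * Complex.I)
            * (Real.exp (-orbitEnergy (β * J) α x n (r * y)) : ℂ)) := by
  have hn' : (0 : ℝ) < n := by exact_mod_cast hn
  have hC : (Real.pi / (n * (β * J) * r ^ 2 / 2 : ℝ) : ℂ) ^ (1 / 2 : ℂ) ≠ 0 := by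
    rw [Complex.cpow_ne_zero_iff_of_exponent_ne_zero (by norm_num)]
    have h1 : n * (β * J) * r ^ 2 / 2 ≠ 0 := by positivity
    exact div_ne_zero (Complex.ofReal_ne_zero.2 Real.pi_ne_zero) (Complex.ofReal_ne_zero.2 h1)
  rw [charFun_map_gibbsMeasure, integral_exp_neg_orbitEnergy hB α x hn hr t,
    integral_exp_neg_orbitEnergy hB α x hn hr 0]
  have hexp : Complex.exp ((t ^ 2 / (2 * (n * (β * J) * r ^ 2)) : ℝ))
      * Complex.exp (-(t ^ 2 / (2 * (n * (β * J) * r ^ 2)) : ℝ)) = 1 := by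
    rw [← Complex.exp_add, add_neg_cancel, Complex.exp_zero]
  have hzero : Complex.exp (-((0 : ℝ) ^ 2 / (2 * (n * (β * J) * r ^ 2)) : ℝ)) = 1 := by simp
  have hsum : ∀ σ : Fin n → ℤˣ,
      Complex.exp (((0 : ℝ) * (magnetization σ / (n * r)) : ℝ) * Complex.I) = 1 := by simp
  simp_rw [hzero, hsum, mul_one]
  have key : ∀ C e e' S W : ℂ, C ≠ 0 → e * e' = 1 → S / W = e * (C * e' * S / (C * W)) := by
    intro C e e' S W hC he
    rw [mul_assoc C, mul_div_mul_left _ _ hC, ← mul_div_assoc, ← mul_assoc, he, one_mul]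
  exact key _ _ _ _ _ hC hexp

end HubbardStratonovich

/-! ### Passage to the limit in characteristic functions. -/

section Limit

/-- Laplace-type convergence of Fourier transforms of densities `exp (-E n)`, under pointwise
convergence of the energies and a uniform quadratic lower bound. -/
theorem tendsto_integral_cexp_mul_exp_neg {E : ℕ → ℝ → ℝ} {ψ : ℝ → ℝ} {c C : ℝ} (hc : 0 < c)
    (hE : ∀ n, Continuous (E n)) (hlim : ∀ y, Tendsto (fun n => E n y) atTop (𝓝 (ψ y)))
    (hlow : ∀ᶠ n in atTop, ∀ y, c * y ^ 2 - C ≤ E n y) {t : ℕ → ℝ} {t₀ : ℝ}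
    (ht : Tendsto t atTop (𝓝 t₀)) :
    Tendsto (fun n => ∫ y : ℝ, Complex.exp (t n * y * Complex.I) * (Real.exp (-E n y) : ℂ))
      atTop (𝓝 (∫ y : ℝ, Complex.exp (t₀ * y * Complex.I) * (Real.exp (-ψ y) : ℂ))) := by
  refine tendsto_integral_filter_of_dominated_convergence
    (fun y => Real.exp C * Real.exp (-c * y ^ 2)) (Eventually.of_forall fun n => ?_) ?_
    ((integrable_exp_neg_mul_sq hc).const_mul _) (Eventually.of_forall fun y => ?_)
  · have := hE n
    exact Continuous.aestronglyMeasurable (by fun_prop)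
  · filter_upwards [hlow] with n hn
    refine Eventually.of_forall fun y => ?_
    have h1 : ‖Complex.exp (t n * y * Complex.I)‖ = 1 := by
      rw [← Complex.ofReal_mul, Complex.norm_exp_ofReal_mul_I]
    rw [norm_mul, h1, one_mul, Complex.norm_real, Real.norm_eq_abs, abs_of_pos (Real.exp_pos _),
      ← Real.exp_add, Real.exp_le_exp]
    linarith [hn y]
  · refine Tendsto.mul ?_ ?_
    · refine (Complex.continuous_exp.tendsto _).comp ?_
      exact ((Complex.continuous_ofReal.tendsto _).comp ht).mul_const _ |>.mul_const _
    · exact (Complex.continuous_ofReal.tendsto _).comp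
        ((Real.continuous_exp.tendsto _).comp (hlim y).neg)

/-- The Fourier transform of the density proportional to `exp (-ψ)`. -/
noncomputable def gibbsCharFun (ψ : ℝ → ℝ) (t : ℝ) : ℂ :=
  (∫ y : ℝ, Complex.exp (t * y * Complex.I) * (Real.exp (-ψ y) : ℂ))
    / ∫ y : ℝ, Complex.exp ((0 : ℝ) * y * Complex.I) * (Real.exp (-ψ y) : ℂ)

theorem gibbsCharFun_zero {ψ : ℝ → ℝ}
    (h : ∫ y : ℝ, Complex.exp ((0 : ℝ) * y * Complex.I) * (Real.exp (-ψ y) : ℂ) ≠ 0) :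
    gibbsCharFun ψ 0 = 1 := div_self h

/-- The discrepancy is `O(n^(γ - κ) |y|)`: it vanishes pointwise, and its linear growth is absorbed
by the quadratic lower bound. The frequency may vary with `n` so that the same result also covers
`M_n / n`. -/
theorem tendsto_charFun_magnetization {β J α x κ γ A w c C : ℝ} {ψ : ℝ → ℝ} (hB : 0 < β * J)
    (hγ : γ < κ) (hdev : ∀ (u : ℝ) (n : ℕ),
      |rotationDeviation (stepLog u) α n x| ≤ A * |u| * (n : ℝ) ^ γ)
    (hlim : ∀ y, Tendsto (fun n : ℕ =>
      n * freeEnergy volume coordinate β J ((n : ℝ) ^ (-κ) * y)) atTop (𝓝 (ψ y)))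
    (hc : 0 < c) (hlow : ∀ n : ℕ, 0 < n → ∀ y,
      c * y ^ 2 - C ≤ n * freeEnergy volume coordinate β J ((n : ℝ) ^ (-κ) * y))
    (hw : Tendsto (fun n : ℕ => 1 / (2 * (n * (β * J) * ((n : ℝ) ^ (-κ)) ^ 2))) atTop (𝓝 w))
    (hψ : ∫ y : ℝ, Complex.exp ((0 : ℝ) * y * Complex.I) * (Real.exp (-ψ y) : ℂ) ≠ 0)
    {t : ℕ → ℝ} {t₀ : ℝ} (ht : Tendsto t atTop (𝓝 t₀)) :
    Tendsto (fun n : ℕ => charFun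
      ((gibbsMeasure (rotation α) coordinate β J (x : UnitAddCircle) n).map
        fun σ => magnetization σ / (n * (n : ℝ) ^ (-κ))) (t n)) atTop
      (𝓝 (Complex.exp ((t₀ ^ 2 * w : ℝ)) * gibbsCharFun ψ t₀)) := by
  set E : ℕ → ℝ → ℝ := fun n y => orbitEnergy (β * J) α x n ((n : ℝ) ^ (-κ) * y) with hE
  have hEcont : ∀ n, Continuous (E n) := fun n =>
    (continuous_orbitEnergy _ _ _ _).comp (by fun_prop)
  have hdevn : ∀ n : ℕ, 0 < n → ∀ y,
      |E n y - n * freeEnergy volume coordinate β J ((n : ℝ) ^ (-κ) * y)|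
        ≤ A * (β * J) * (n : ℝ) ^ (γ - κ) * |y| := by
    intro n hn y
    have hn' : (0 : ℝ) < n := by exact_mod_cast hn
    simp only [hE]
    rw [orbitEnergy_eq, sub_sub_cancel_left, abs_neg]
    refine (hdev _ n).trans (le_of_eq ?_)
    rw [abs_mul (β * J), abs_mul _ y, abs_of_pos hB, abs_of_pos (Real.rpow_pos_of_pos hn' _),
      sub_eq_add_neg, Real.rpow_add hn']
    ring
  have hpow : Tendsto (fun n : ℕ => A * (β * J) * (n : ℝ) ^ (γ - κ)) atTop (𝓝 0) := by
    have h1 := (tendsto_rpow_neg_atTop (sub_pos.2 hγ)).comp tendsto_natCast_atTop_atTop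
    have h2 := h1.const_mul (A * (β * J))
    rw [mul_zero] at h2
    refine h2.congr fun n => ?_
    rw [Function.comp_apply, neg_sub]
  have hElim : ∀ y, Tendsto (fun n => E n y) atTop (𝓝 (ψ y)) := by
    intro y
    have h1 : Tendsto (fun n => E n y
        - n * freeEnergy volume coordinate β J ((n : ℝ) ^ (-κ) * y)) atTop (𝓝 0) := by
      refine squeeze_zero_norm' (a := fun n : ℕ => A * (β * J) * (n : ℝ) ^ (γ - κ) * |y|) ?_ ?_
      · filter_upwards [eventually_gt_atTop 0] with n hn
        exact hdevn n hn y
      · simpa using hpow.mul_const |y|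
    simpa using h1.add (hlim y)
  have hElow : ∀ᶠ n in atTop, ∀ y, c / 2 * y ^ 2 - (C + 1 / (2 * c)) ≤ E n y := by
    filter_upwards [eventually_gt_atTop 0, hpow.eventually (gt_mem_nhds zero_lt_one)]
      with n hn hn1 y
    have h1 := (abs_le.1 (hdevn n hn y)).1
    have h2 := hlow n hn y
    have h3 : A * (β * J) * (n : ℝ) ^ (γ - κ) * |y| ≤ 1 * |y| :=
      mul_le_mul_of_nonneg_right hn1.le (abs_nonneg y)
    -- Half of the quadratic coefficient is spent to dominate the linear error.
    have h4 : |y| ≤ c / 2 * y ^ 2 + 1 / (2 * c) := by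
      have h5 : c / 2 * y ^ 2 + 1 / (2 * c) - |y| = c / 2 * (|y| - 1 / c) ^ 2 := by
        rw [sub_sq, sq_abs]
        field_simp
        ring
      have h6 : 0 ≤ c / 2 * (|y| - 1 / c) ^ 2 := by positivity
      linarith
    linarith
  have hnum := tendsto_integral_cexp_mul_exp_neg (half_pos hc) hEcont hElim hElow ht
  have hden := tendsto_integral_cexp_mul_exp_neg (half_pos hc) hEcont hElim hElow
    (tendsto_const_nhds (x := (0 : ℝ)))
  have hexp : Tendsto (fun n : ℕ => Complex.exp
      ((t n ^ 2 / (2 * (n * (β * J) * ((n : ℝ) ^ (-κ)) ^ 2)) : ℝ))) atTop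
      (𝓝 (Complex.exp ((t₀ ^ 2 * w : ℝ)))) := by
    refine (Complex.continuous_exp.tendsto _).comp ((Complex.continuous_ofReal.tendsto _).comp ?_)
    refine ((ht.pow 2).mul hw).congr fun n => ?_
    rw [mul_one_div]
  refine (hexp.mul (hnum.div hden hψ)).congr' ?_
  filter_upwards [eventually_gt_atTop 0] with n hn
  have hn' : (0 : ℝ) < n := by exact_mod_cast hn
  exact (charFun_magnetization hB α x hn (Real.rpow_pos_of_pos hn' _) (t n)).symm

theorem tendstoInDistribution_of_charFun {Ω : ℕ → Type*} {m : ∀ n, MeasurableSpace (Ω n)}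
    {P : ∀ n, Measure (Ω n)} [∀ n, IsProbabilityMeasure (P n)] {X : ∀ n, Ω n → ℝ}
    {μ : Measure ℝ} [IsProbabilityMeasure μ] (hX : ∀ n, Measurable (X n))
    (h : ∀ t, Tendsto (fun n => charFun ((P n).map (X n)) t) atTop (𝓝 (charFun μ t))) :
    TendstoInDistribution X atTop (id : ℝ → ℝ) P μ where
  forall_aemeasurable n := (hX n).aemeasurable
  aemeasurable_limit := aemeasurable_id
  tendsto := by
    refine ProbabilityMeasure.tendsto_iff_tendsto_charFun.2 fun t => ?_
    simpa using h t

theorem tendstoInDistribution_magnetization {β J α x κ γ A w c C : ℝ} {ψ : ℝ → ℝ}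
    (hB : 0 < β * J) (hκ : 0 < κ) (hγ : γ < κ) (hdev : ∀ (u : ℝ) (n : ℕ),
      |rotationDeviation (stepLog u) α n x| ≤ A * |u| * (n : ℝ) ^ γ)
    (hlim : ∀ y, Tendsto (fun n : ℕ =>
      n * freeEnergy volume coordinate β J ((n : ℝ) ^ (-κ) * y)) atTop (𝓝 (ψ y)))
    (hc : 0 < c) (hlow : ∀ n : ℕ, 0 < n → ∀ y,
      c * y ^ 2 - C ≤ n * freeEnergy volume coordinate β J ((n : ℝ) ^ (-κ) * y))
    (hw : Tendsto (fun n : ℕ => 1 / (2 * (n * (β * J) * ((n : ℝ) ^ (-κ)) ^ 2))) atTop (𝓝 w))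
    (hψ : ∫ y : ℝ, Complex.exp ((0 : ℝ) * y * Complex.I) * (Real.exp (-ψ y) : ℂ) ≠ 0)
    {d : ℕ → ℝ} (hd : ∀ n : ℕ, 0 < n → d n = n * (n : ℝ) ^ (-κ))
    {μ : Measure ℝ} [IsProbabilityMeasure μ]
    (hμ : ∀ t, charFun μ t = Complex.exp ((t ^ 2 * w : ℝ)) * gibbsCharFun ψ t) :
    TendstoInDistribution (fun (n : ℕ) (σ : Fin n → ℤˣ) => magnetization σ / (n : ℝ))
      atTop (id : ℝ → ℝ)
      (fun n => gibbsMeasure (rotation α) coordinate β J (x : UnitAddCircle) n)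
      (Measure.dirac (0 : ℝ)) ∧
    TendstoInDistribution (fun (n : ℕ) (σ : Fin n → ℤˣ) => magnetization σ / d n)
      atTop (id : ℝ → ℝ)
      (fun n => gibbsMeasure (rotation α) coordinate β J (x : UnitAddCircle) n) μ := by
  constructor
  · refine tendstoInDistribution_of_charFun (fun n => measurable_of_finite _) fun t => ?_
    -- The characteristic function of `M_n / n` at `t` is that of `M_n / n^(1 - κ)` at `n^(-κ) t`, a
    -- frequency tending to `0`.
    have ht : Tendsto (fun n : ℕ => (n : ℝ) ^ (-κ) * t) atTop (𝓝 0) := by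
      have h1 := (tendsto_rpow_neg_atTop hκ).comp tendsto_natCast_atTop_atTop
      simpa using h1.mul_const t
    have h := tendsto_charFun_magnetization hB hγ hdev hlim hc hlow hw hψ ht
    rw [gibbsCharFun_zero hψ] at h
    simp only [ne_eq, OfNat.ofNat_ne_zero, not_false_eq_true, zero_pow, zero_mul,
      Complex.ofReal_zero, Complex.exp_zero, mul_one] at h
    have h0 : charFun (Measure.dirac (0 : ℝ)) t = 1 := by simp [charFun_dirac]
    rw [h0]
    refine h.congr' ?_
    filter_upwards [eventually_gt_atTop 0] with n hn
    have hn' : (0 : ℝ) < n := by exact_mod_cast hn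
    have hr := Real.rpow_pos_of_pos hn' (-κ)
    rw [charFun_map_gibbsMeasure, charFun_map_gibbsMeasure]
    congr 1
    refine Finset.sum_congr rfl fun σ _ => ?_
    congr 4
    field_simp
  · refine tendstoInDistribution_of_charFun (fun n => measurable_of_finite _) fun t => ?_
    have h := tendsto_charFun_magnetization hB hγ hdev hlim hc hlow hw hψ
      (tendsto_const_nhds (x := t))
    rw [hμ]
    refine h.congr' ?_
    filter_upwards [eventually_gt_atTop 0] with n hn
    rw [hd n hn]

/-- The scaled free energy splits into its quadratic part and the defect of `Λ`. -/
theorem mul_freeEnergy_scaled (β J κ y : ℝ) {n : ℕ} (hn : 0 < n) :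
    n * freeEnergy volume coordinate β J ((n : ℝ) ^ (-κ) * y)
      = (β * J / 2 - (β * J) ^ 2 / 3) * (n : ℝ) ^ (1 - 2 * κ) * y ^ 2
        + n * logMomentDefect (β * J * ((n : ℝ) ^ (-κ) * y)) := by
  have hn' : (0 : ℝ) < n := by exact_mod_cast hn
  have h1 : (n : ℝ) ^ (1 - 2 * κ) = n * ((n : ℝ) ^ (-κ)) ^ 2 := by
    rw [← Real.rpow_natCast, ← Real.rpow_mul hn'.le]
    nth_rewrite 2 [← Real.rpow_one (n : ℝ)]
    rw [← Real.rpow_add hn']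
    congr 1
    push_cast
    ring
  rw [freeEnergy_coordinate, h1]
  ring

/-- The defect is asymptotic to `u⁴ / 45`. The limit `L` is `0` for `κ = 1/2` and `1` for `κ = 1/4`,
which treats both regimes at once. -/
theorem tendsto_mul_logMomentDefect {B κ L : ℝ} (hB : 0 < B) (hκ : 0 < κ)
    (hL : Tendsto (fun n : ℕ => (n : ℝ) ^ (1 - 4 * κ)) atTop (𝓝 L)) (y : ℝ) :
    Tendsto (fun n : ℕ => n * logMomentDefect (B * ((n : ℝ) ^ (-κ) * y))) atTop
      (𝓝 (L * B ^ 4 / 45 * y ^ 4)) := by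
  rcases eq_or_ne y 0 with rfl | hy
  · simp
  have h1 : Tendsto (fun n : ℕ => B * ((n : ℝ) ^ (-κ) * y)) atTop (𝓝[≠] 0) := by
    rw [tendsto_nhdsWithin_iff]
    constructor
    · have h1 := (tendsto_rpow_neg_atTop hκ).comp tendsto_natCast_atTop_atTop
      simpa using (h1.mul_const y).const_mul B
    · filter_upwards [eventually_gt_atTop 0] with n hn
      have hn' : (0 : ℝ) < n := by exact_mod_cast hn
      exact mul_ne_zero hB.ne' (mul_ne_zero (Real.rpow_pos_of_pos hn' _).ne' hy)
  have h2 := (hL.mul_const (B ^ 4 * y ^ 4)).mul (tendsto_logMomentDefect_div_pow_four.comp h1)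
  rw [show L * B ^ 4 / 45 * y ^ 4 = L * (B ^ 4 * y ^ 4) * (1 / 45) by ring]
  refine h2.congr' ?_
  filter_upwards [eventually_gt_atTop 0] with n hn
  have hn' : (0 : ℝ) < n := by exact_mod_cast hn
  have hr := Real.rpow_pos_of_pos hn' (-κ)
  have h3 : (n : ℝ) ^ (1 - 4 * κ) = n * ((n : ℝ) ^ (-κ)) ^ 4 := by
    rw [← Real.rpow_natCast, ← Real.rpow_mul hn'.le]
    nth_rewrite 2 [← Real.rpow_one (n : ℝ)]
    rw [← Real.rpow_add hn']
    congr 1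
    push_cast
    ring
  rw [Function.comp_apply, h3]
  field_simp

end Limit

/-! ### The quartic limit law and its normalization. -/

section QuarticLaw

theorem integrable_exp_neg_quartic : Integrable fun s : ℝ => Real.exp (-(9 / 80 * s ^ 4)) := by
  refine ((integrable_exp_neg_mul_sq (b := 9 / 80) (by norm_num)).const_mul
    (Real.exp (9 / 80))).mono' (by fun_prop) (Eventually.of_forall fun s => ?_)
  rw [Real.norm_eq_abs, abs_of_pos (Real.exp_pos _), ← Real.exp_add, Real.exp_le_exp]
  nlinarith [sq_nonneg (s ^ 2 - 1)]

theorem integral_exp_neg_quartic :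
    ∫ s : ℝ, Real.exp (-(9 / 80 * s ^ 4))
      = 2 * ((9 / 80 : ℝ) ^ (-1 / 4 : ℝ) * (1 / 4 * Real.Gamma (1 / 4))) := by
  have h1 := integral_comp_abs (f := fun s : ℝ => Real.exp (-(9 / 80 * s ^ 4)))
  have h2 := integral_exp_neg_mul_rpow (p := 4) (b := 9 / 80) (by norm_num) (by norm_num)
  have h3 : ∀ s : ℝ, |s| ^ 4 = s ^ 4 := fun s => Even.pow_abs (by decide) s
  simp_rw [h3] at h1
  rw [h1, ← Real.Gamma_add_one (by norm_num), ← h2]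
  congr 2
  funext s
  congr 1
  rw [neg_mul]
  norm_cast

/-- The normalizing constant of `quarticLaw`. -/
noncomputable def quarticConst : ℝ :=
  Real.sqrt 3 * Real.Gamma (3 / 4) / (Real.sqrt 2 * Real.pi * (5 : ℝ) ^ (1 / 4 : ℝ))

theorem quarticConst_pos : 0 < quarticConst := by
  have := Real.Gamma_pos_of_pos (show (0 : ℝ) < 3 / 4 by norm_num)
  have := Real.pi_pos
  unfold quarticConst
  positivity

/-- The reflection formula at `1/4` trades `Γ(1/4)` for `π √2 / Γ(3/4)`, and `80 = 16 · 5`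
simplifies the fourth root. -/
theorem quarticConst_mul_integral :
    quarticConst * ∫ s : ℝ, Real.exp (-(9 / 80 * s ^ 4)) = 1 := by
  have hpow : (9 / 80 : ℝ) ^ (-1 / 4 : ℝ) = 2 * (5 : ℝ) ^ (1 / 4 : ℝ) / Real.sqrt 3 := by
    have h16 : (16 : ℝ) ^ (1 / 4 : ℝ) = 2 := by
      rw [show (16 : ℝ) = 2 ^ (4 : ℝ) by norm_num, ← Real.rpow_mul (by norm_num)]
      norm_num
    have h9 : (9 : ℝ) ^ (1 / 4 : ℝ) = Real.sqrt 3 := by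
      rw [Real.sqrt_eq_rpow, show (9 : ℝ) = 3 ^ (2 : ℝ) by norm_num,
        ← Real.rpow_mul (by norm_num)]
      norm_num
    rw [show (-1 / 4 : ℝ) = -(1 / 4) by norm_num, Real.rpow_neg (by norm_num),
      Real.div_rpow (by norm_num) (by norm_num), inv_div, show (80 : ℝ) = 16 * 5 by norm_num,
      Real.mul_rpow (by norm_num) (by norm_num), h16, h9]
  have hrefl : Real.Gamma (1 / 4) * Real.Gamma (3 / 4) = Real.pi * Real.sqrt 2 := by
    have h := Real.Gamma_mul_Gamma_one_sub (1 / 4)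
    rw [show (1 - 1 / 4 : ℝ) = 3 / 4 by norm_num, mul_one_div, Real.sin_pi_div_four] at h
    rw [h]
    have h2 : Real.sqrt 2 * Real.sqrt 2 = 2 := Real.mul_self_sqrt (by norm_num)
    have h3 : Real.sqrt 2 ≠ 0 := by positivity
    field_simp
    linarith
  have h3 : Real.sqrt 3 ≠ 0 := by positivity
  have h2 : Real.sqrt 2 ≠ 0 := by positivity
  have h5 : (5 : ℝ) ^ (1 / 4 : ℝ) ≠ 0 := by positivity
  have hpi := Real.pi_ne_zero
  rw [integral_exp_neg_quartic, hpow, quarticConst]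
  calc _ = Real.Gamma (1 / 4) * Real.Gamma (3 / 4) / (Real.pi * Real.sqrt 2) := by
        field_simp
        ring
    _ = 1 := by
        rw [hrefl]
        exact div_self (mul_ne_zero hpi h2)

theorem quarticLaw_eq : quarticLaw = volume.withDensity fun s =>
    ENNReal.ofReal (quarticConst * Real.exp (-(9 / 80 * s ^ 4))) := by
  have : ∀ s : ℝ, -9 * s ^ 4 / 80 = -(9 / 80 * s ^ 4) := fun s => by ring
  simp only [quarticLaw, quarticConst, this]

theorem isProbabilityMeasure_quarticLaw : IsProbabilityMeasure quarticLaw := by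
  constructor
  rw [quarticLaw_eq, withDensity_apply _ MeasurableSet.univ, Measure.restrict_univ,
    ← ofReal_integral_eq_lintegral_ofReal (integrable_exp_neg_quartic.const_mul _)
      (Eventually.of_forall fun s => mul_nonneg quarticConst_pos.le (Real.exp_pos _).le),
    integral_const_mul, quarticConst_mul_integral, ENNReal.ofReal_one]

theorem integral_cexp_zero_mul_exp (ψ : ℝ → ℝ) :
    ∫ y : ℝ, Complex.exp ((0 : ℝ) * y * Complex.I) * (Real.exp (-ψ y) : ℂ)
      = ((∫ y : ℝ, Real.exp (-ψ y) : ℝ) : ℂ) := by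
  rw [← integral_complex_ofReal]
  simp

theorem charFun_quarticLaw (t : ℝ) :
    charFun quarticLaw t = gibbsCharFun (fun s => 9 / 80 * s ^ 4) t := by
  have hI : (quarticConst : ℂ) * ((∫ s : ℝ, Real.exp (-(9 / 80 * s ^ 4)) : ℝ) : ℂ) = 1 := by
    rw [← Complex.ofReal_mul, quarticConst_mul_integral, Complex.ofReal_one]
  rw [charFun_apply_real, quarticLaw_eq, integral_withDensity_eq_integral_toReal_smul (by fun_prop)
    (Eventually.of_forall fun s => ENNReal.ofReal_lt_top), gibbsCharFun,
    integral_cexp_zero_mul_exp, eq_div_iff (right_ne_zero_of_mul_eq_one hI)]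
  have h1 : ∀ s : ℝ, (ENNReal.ofReal (quarticConst * Real.exp (-(9 / 80 * s ^ 4)))).toReal
        • Complex.exp (t * s * Complex.I)
      = quarticConst * (Complex.exp (t * s * Complex.I)
        * (Real.exp (-(9 / 80 * s ^ 4)) : ℂ)) := by
    intro s
    rw [ENNReal.toReal_ofReal (mul_nonneg quarticConst_pos.le (Real.exp_pos _).le),
      Complex.real_smul]
    push_cast
    ring
  simp_rw [h1]
  rw [integral_const_mul, mul_right_comm, hI, one_mul]

end QuarticLaw

/-! ### Fourier transform of a Gaussian density. -/

section Quadratic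

theorem integral_cexp_mul_exp_neg_sq {a : ℝ} (ha : 0 < a) (t : ℝ) :
    ∫ y : ℝ, Complex.exp (t * y * Complex.I) * (Real.exp (-(a * y ^ 2)) : ℂ)
      = (Real.pi / a : ℂ) ^ (1 / 2 : ℂ) * Complex.exp ((-(t ^ 2 / (4 * a)) : ℝ)) := by
  rw [show (-(t ^ 2 / (4 * a)) : ℝ) = -t ^ 2 / (4 * a) by ring]
  push_cast
  rw [← fourierIntegral_gaussian (b := (a : ℂ)) (by simpa using ha) (t : ℂ)]
  congr 1
  funext y
  congr 2 <;> ring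

theorem gibbsCharFun_sq {a : ℝ} (ha : 0 < a) (t : ℝ) :
    gibbsCharFun (fun y => a * y ^ 2) t = Complex.exp ((-(t ^ 2 / (4 * a)) : ℝ)) := by
  have hC : (Real.pi / a : ℂ) ^ (1 / 2 : ℂ) ≠ 0 := by
    rw [Complex.cpow_ne_zero_iff_of_exponent_ne_zero (by norm_num)]
    exact div_ne_zero (Complex.ofReal_ne_zero.2 Real.pi_ne_zero) (Complex.ofReal_ne_zero.2 ha.ne')
  rw [gibbsCharFun, integral_cexp_mul_exp_neg_sq ha, integral_cexp_mul_exp_neg_sq ha,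
    mul_div_mul_left _ _ hC]
  simp

end Quadratic

/-! ### The subcritical and critical limit theorems. -/

section Limits

theorem natCast_mul_rpow_neg {n : ℕ} (hn : 0 < n) (κ : ℝ) :
    (n : ℝ) * (n : ℝ) ^ (-κ) = (n : ℝ) ^ (1 - κ) := by
  have hn' : (0 : ℝ) < n := by exact_mod_cast hn
  rw [sub_eq_add_neg, Real.rpow_add hn', Real.rpow_one]

theorem natCast_mul_rpow_neg_sq {n : ℕ} (hn : 0 < n) (κ : ℝ) :
    (n : ℝ) * ((n : ℝ) ^ (-κ)) ^ 2 = (n : ℝ) ^ (1 - 2 * κ) := by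
  have hn' : (0 : ℝ) < n := by exact_mod_cast hn
  rw [sq, ← mul_assoc, natCast_mul_rpow_neg hn, ← Real.rpow_add hn']
  congr 1
  ring

/-- At `κ = 1/2` the limiting energy is `a y²` with `a = B/2 - B²/3`, a Gaussian of variance
`1/(2a)`. Since `n r² = 1`, the auxiliary noise keeps variance `1/B`, and `1/(2a) - 1/B = 2 / (3 -
2B)`. -/
theorem tendstoInDistribution_magnetization_subcritical {β J α η : ℝ} (hB : 0 < β * J)
    (hB' : β * J < 3 / 2) (h : HasType α η) (hη : η < 2) (x : ℝ) :
    TendstoInDistribution (fun (n : ℕ) (σ : Fin n → ℤˣ) => magnetization σ / (n : ℝ))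
      atTop (id : ℝ → ℝ)
      (fun n => gibbsMeasure (rotation α) coordinate β J (x : UnitAddCircle) n)
      (Measure.dirac (0 : ℝ)) ∧
    TendstoInDistribution (fun (n : ℕ) (σ : Fin n → ℤˣ) => magnetization σ / Real.sqrt (n : ℝ))
      atTop (id : ℝ → ℝ)
      (fun n => gibbsMeasure (rotation α) coordinate β J (x : UnitAddCircle) n)
      (gaussianReal 0 (Real.toNNReal (2 / (3 - 2 * β * J)))) := by
  obtain ⟨A, γ, hγ, hdev⟩ := h.exists_stepLog_deviation_le (κ := 1 / 2) (by norm_num)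
    (by norm_num) (by norm_num; exact hη)
  have ha : 0 < β * J / 2 - (β * J) ^ 2 / 3 := by nlinarith
  refine tendstoInDistribution_magnetization (κ := 1 / 2) (A := A) (γ := γ)
    (ψ := fun y => (β * J / 2 - (β * J) ^ 2 / 3) * y ^ 2)
    (c := β * J / 2 - (β * J) ^ 2 / 3) (C := 0) (w := 1 / (2 * (β * J)))
    hB (by norm_num) hγ (fun u n => hdev u n x) (fun y => ?_) ha (fun n hn y => ?_) ?_ ?_
    (fun n hn => ?_) fun t => ?_
  · have hL : Tendsto (fun n : ℕ => (n : ℝ) ^ (1 - 4 * (1 / 2) : ℝ)) atTop (𝓝 0) := by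
      have h1 := (tendsto_rpow_neg_atTop (zero_lt_one' ℝ)).comp tendsto_natCast_atTop_atTop
      refine h1.congr fun n => ?_
      norm_num
    have h2 := (tendsto_mul_logMomentDefect hB (by norm_num) hL y).const_add
      ((β * J / 2 - (β * J) ^ 2 / 3) * y ^ 2)
    rw [zero_mul, zero_div, zero_mul, add_zero] at h2
    refine h2.congr' ?_
    filter_upwards [eventually_gt_atTop 0] with n hn
    rw [mul_freeEnergy_scaled _ _ _ _ hn]
    norm_num
  · rw [mul_freeEnergy_scaled _ _ _ _ hn]
    have h1 := mul_nonneg (Nat.cast_nonneg n)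
      (logMomentDefect_nonneg (β * J * ((n : ℝ) ^ (-(1 / 2 : ℝ)) * y)))
    norm_num at h1 ⊢
    exact h1
  · refine tendsto_const_nhds.congr' ?_
    filter_upwards [eventually_gt_atTop 0] with n hn
    rw [mul_right_comm, natCast_mul_rpow_neg_sq hn]
    norm_num
  · rw [integral_cexp_mul_exp_neg_sq ha]
    refine mul_ne_zero ?_ (Complex.exp_ne_zero _)
    rw [Complex.cpow_ne_zero_iff_of_exponent_ne_zero (by norm_num)]
    exact div_ne_zero (Complex.ofReal_ne_zero.2 Real.pi_ne_zero) (Complex.ofReal_ne_zero.2 ha.ne')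
  · rw [natCast_mul_rpow_neg hn, Real.sqrt_eq_rpow]
    norm_num
  · have hpos : 0 < 3 - 2 * β * J := by linarith
    rw [charFun_gaussianReal, gibbsCharFun_sq ha, ← Complex.exp_add,
      Real.coe_toNNReal _ (by positivity), Complex.ofReal_zero, mul_zero, zero_mul, zero_sub]
    congr 1
    norm_cast
    have hB0 : β * J ≠ 0 := hB.ne'
    have h1 : β * J / 2 - (β * J) ^ 2 / 3 = β * J * (3 - 2 * β * J) / 6 := by ring
    rw [h1]
    have hβ : β ≠ 0 := left_ne_zero_of_mul hB0
    have hJ : J ≠ 0 := right_ne_zero_of_mul hB0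
    have h3 := hpos.ne'
    field_simp
    ring

/-- At `κ = 1/4` the quartic coefficient is `(3/2)⁴ / 45 = 9/80`, and the noise dies out because `n
r² = √n`. -/
theorem tendstoInDistribution_magnetization_critical {β J α η : ℝ} (hB : β * J = 3 / 2)
    (h : HasType α η) (hη : η < 4 / 3) (x : ℝ) [IsProbabilityMeasure quarticLaw] :
    TendstoInDistribution (fun (n : ℕ) (σ : Fin n → ℤˣ) => magnetization σ / (n : ℝ))
      atTop (id : ℝ → ℝ)
      (fun n => gibbsMeasure (rotation α) coordinate β J (x : UnitAddCircle) n)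
      (Measure.dirac (0 : ℝ)) ∧
    TendstoInDistribution
      (fun (n : ℕ) (σ : Fin n → ℤˣ) => magnetization σ / (n : ℝ) ^ (3 / 4 : ℝ))
      atTop (id : ℝ → ℝ)
      (fun n => gibbsMeasure (rotation α) coordinate β J (x : UnitAddCircle) n) quarticLaw := by
  obtain ⟨A, γ, hγ, hdev⟩ := h.exists_stepLog_deviation_le (κ := 1 / 4) (by norm_num)
    (by norm_num) (by norm_num; exact hη)
  obtain ⟨c, hc, hlow⟩ := exists_logMomentDefect_lower_bound
  have hfree : ∀ n : ℕ, 0 < n → ∀ y : ℝ,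
      n * freeEnergy volume coordinate β J ((n : ℝ) ^ (-(1 / 4) : ℝ) * y)
        = n * logMomentDefect (3 / 2 * ((n : ℝ) ^ (-(1 / 4) : ℝ) * y)) := by
    intro n hn y
    rw [mul_freeEnergy_scaled _ _ _ _ hn, hB]
    ring
  refine tendstoInDistribution_magnetization (κ := 1 / 4) (A := A) (γ := γ)
    (ψ := fun y => 9 / 80 * y ^ 4) (c := c) (C := c) (w := 0)
    (by rw [hB]; norm_num) (by norm_num) hγ (fun u n => hdev u n x) (fun y => ?_) hc
    (fun n hn y => ?_) ?_ ?_ (fun n hn => ?_) fun t => ?_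
  · have hL : Tendsto (fun n : ℕ => (n : ℝ) ^ (1 - 4 * (1 / 4) : ℝ)) atTop (𝓝 1) := by
      norm_num
    have h2 := tendsto_mul_logMomentDefect (B := 3 / 2) (by norm_num) (by norm_num) hL y
    rw [show 1 * (3 / 2 : ℝ) ^ 4 / 45 * y ^ 4 = 9 / 80 * y ^ 4 by ring] at h2
    refine h2.congr' ?_
    filter_upwards [eventually_gt_atTop 0] with n hn
    rw [hfree n hn]
  · rw [hfree n hn]
    have hn' : (0 : ℝ) < n := by exact_mod_cast hn
    have hn1 : (1 : ℝ) ≤ n := by exact_mod_cast hn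
    set r := (n : ℝ) ^ (-(1 / 4) : ℝ) with hr
    have hr4 : n * r ^ 4 = 1 := by
      rw [hr, ← Real.rpow_natCast, ← Real.rpow_mul hn'.le]
      rw [show (-(1 / 4) : ℝ) * (4 : ℕ) = -1 by norm_num, Real.rpow_neg_one]
      exact mul_inv_cancel₀ hn'.ne'
    have hr2 : 1 ≤ n * r ^ 2 := by
      rw [hr, natCast_mul_rpow_neg_sq hn]
      exact Real.one_le_rpow hn1 (by norm_num)
    -- The quartic branch is `81/16 · y⁴`, which exceeds `y² - 1`; the quadratic branch is at least
    -- `9/4 · y²` because `n r² ≥ 1`.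
    have h1 : y ^ 2 - 1 ≤ n * min ((3 / 2 * (r * y)) ^ 4) ((3 / 2 * (r * y)) ^ 2) := by
      rw [mul_min_of_nonneg _ _ hn'.le, le_min_iff]
      constructor
      · have h2 : n * (3 / 2 * (r * y)) ^ 4 = 81 / 16 * (n * r ^ 4) * y ^ 4 := by ring
        rw [h2, hr4]
        nlinarith [sq_nonneg (y ^ 2 - 1)]
      · have h2 : n * (3 / 2 * (r * y)) ^ 2 = 9 / 4 * (n * r ^ 2) * y ^ 2 := by ring
        rw [h2]
        nlinarith [sq_nonneg y]
    calc c * y ^ 2 - c = c * (y ^ 2 - 1) := by ring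
      _ ≤ c * (n * min ((3 / 2 * (r * y)) ^ 4) ((3 / 2 * (r * y)) ^ 2)) := by gcongr
      _ = n * (c * min ((3 / 2 * (r * y)) ^ 4) ((3 / 2 * (r * y)) ^ 2)) := by ring
      _ ≤ _ := by gcongr; exact hlow _
  · have h1 := (tendsto_rpow_neg_atTop (show (0 : ℝ) < 1 / 2 by norm_num)).comp
      tendsto_natCast_atTop_atTop
    have h2 := h1.const_mul (1 / 3)
    rw [mul_zero] at h2
    refine h2.congr' ?_
    filter_upwards [eventually_gt_atTop 0] with n hn
    have hn' : (0 : ℝ) < n := by exact_mod_cast hn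
    rw [mul_right_comm, natCast_mul_rpow_neg_sq hn, hB, Function.comp_apply,
      Real.rpow_neg hn'.le]
    norm_num
    ring
  · rw [integral_cexp_zero_mul_exp (fun y => 9 / 80 * y ^ 4), Complex.ofReal_ne_zero]
    exact right_ne_zero_of_mul_eq_one quarticConst_mul_integral
  · rw [natCast_mul_rpow_neg hn]
    norm_num
  · rw [charFun_quarticLaw, mul_zero, Complex.ofReal_zero, Complex.exp_zero, one_mul]

end Limits

end CurieWeiss

theorem mainTheorem6 (J : ℝ) (hJ : 0 < J) :
    CurieWeiss.criticalBeta (volume : Measure UnitAddCircle) CurieWeiss.coordinate J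
        = 3 / (2 * J) ∧
    ∀ (α η : ℝ), Irrational α → CurieWeiss.HasType α η → ∀ x : UnitAddCircle,
      (∀ β : ℝ, 0 < β →
        β < CurieWeiss.criticalBeta (volume : Measure UnitAddCircle) CurieWeiss.coordinate J →
        η < 2 →
          TendstoInDistribution
            (fun (n : ℕ) (σ : Fin n → ℤˣ) => CurieWeiss.magnetization σ / (n : ℝ))
            atTop (id : ℝ → ℝ)
            (fun n => CurieWeiss.gibbsMeasure (CurieWeiss.rotation α) CurieWeiss.coordinate β J x n)
            (Measure.dirac (0 : ℝ)) ∧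
          TendstoInDistribution
            (fun (n : ℕ) (σ : Fin n → ℤˣ) => CurieWeiss.magnetization σ / Real.sqrt (n : ℝ))
            atTop (id : ℝ → ℝ)
            (fun n => CurieWeiss.gibbsMeasure (CurieWeiss.rotation α) CurieWeiss.coordinate β J x n)
            (gaussianReal 0 (Real.toNNReal (2 / (3 - 2 * β * J))))) ∧
      (∀ β : ℝ,
        β = CurieWeiss.criticalBeta (volume : Measure UnitAddCircle) CurieWeiss.coordinate J →
        η < 4 / 3 →
          TendstoInDistribution
            (fun (n : ℕ) (σ : Fin n → ℤˣ) => CurieWeiss.magnetization σ / (n : ℝ))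
            atTop (id : ℝ → ℝ)
            (fun n => CurieWeiss.gibbsMeasure (CurieWeiss.rotation α) CurieWeiss.coordinate β J x n)
            (Measure.dirac (0 : ℝ)) ∧
          ∃ _ : IsProbabilityMeasure CurieWeiss.quarticLaw,
            TendstoInDistribution
              (fun (n : ℕ) (σ : Fin n → ℤˣ) =>
                CurieWeiss.magnetization σ / (n : ℝ) ^ (3 / 4 : ℝ))
              atTop (id : ℝ → ℝ)
              (fun n =>
                CurieWeiss.gibbsMeasure (CurieWeiss.rotation α) CurieWeiss.coordinate β J x n)
              CurieWeiss.quarticLaw) := by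
  refine ⟨CurieWeiss.criticalBeta_coordinate hJ, fun α η _ hη x => ?_⟩
  rw [CurieWeiss.criticalBeta_coordinate hJ]
  obtain ⟨x, rfl⟩ := QuotientAddGroup.mk_surjective x
  refine ⟨fun β hβ hlt h2 => ?_, fun β hβ h43 => ?_⟩
  · rw [lt_div_iff₀ (by positivity)] at hlt
    exact CurieWeiss.tendstoInDistribution_magnetization_subcritical (mul_pos hβ hJ)
      (by linarith) hη h2 x
  · have hB : β * J = 3 / 2 := by
      rw [hβ]
      field_simp
    have := CurieWeiss.isProbabilityMeasure_quarticLaw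
    obtain ⟨h1, h2⟩ := CurieWeiss.tendstoInDistribution_magnetization_critical hB hη h43 x
    exact ⟨h1, CurieWeiss.isProbabilityMeasure_quarticLaw, h2⟩
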